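/- Let $\mathcal T$ be a topograph: a tree drawn in the plane with all vertices of degree $3$, whose complementary regions carry integer labels such that, for every edge, if $r,u$ are the labels of the regions at its two ends and $s,t$ those of the regions on its two sides, then $r+u=2(s+t)$. The edge directed from $r$ to $u$ has label $u-(s+t)$ (and the opposite direction has the negative label). The discriminant of $\mathcal T$ is $D=-ef-fg-ge$, where $e,f,g$ are the labels of the three edges directed away from a vertex; it does not depend on the vertex. A region with label $0$ is called a lake, and an edge between a positively and a negatively labelled region is called a river edge. Suppose $D=m^2$ with an integer $m\ge 1$. Then $\mathcal T$ has exactly two lakes, and the labels of the regions adjacent to a given lake lie in one congruence class modulo $m$; let $r$ and $s$ denote these classes for the two lakes. Let $\mathcal T_\star$ be $\mathcal T$ with all river edges relabelled with $\sqrt D=m$ when directed rightwards (that is, with the positive region on the left). For $x\in\mathbb R$ put $$W_1(x)=2\,\mathrm{Re}\int_0^\infty \frac{y}{y^2+1}\cdot\frac{1}{e^{\pi(y+2ix)}-1}\,dy .$$ If the two lakes are not adjacent, then $$m^3\sum_{v}\frac1{|efg|}+W_1\!\left(\frac rm\right)+W_1\!\left(\frac sm\right)=2\log\!\left(\frac{m}{2\gcd(m,r)}\right),$$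 where the sum is over all vertices $v$ of $\mathcal T_\star$ that are not on a lake, $e,f,g$ are the labels in $\mathcal T_\star$ of the three edges directed away from $v$, and the series converges. If the two lakes are adjacent (which is always so for $m=1$), the series also converges and the same formula holds with $2$ added to the right-hand side. -/

import Mathlib

/-- A tree drawn in the plane all of whose vertices have degree `3`. The drawing is recorded, up to
isotopy, by the rotation system: `rot d` is the dart (directed edge) that follows `d`
counterclockwise among the darts leaving the vertex `d.fst`. -/
structure PlaneCubicTree (V : Type*) where
  /-- the underlying graph -/
  graph : SimpleGraph V
  isTree : graph.IsTree
  degree_three : ∀ v, (graph.neighborSet v).ncard = 3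
  /-- the counterclockwise successor around the starting vertex -/
  rot : Equiv.Perm graph.Dart
  rot_fst : ∀ d, (rot d).fst = d.fst
  rot_cyclic : ∀ d d' : graph.Dart, d.fst = d'.fst → rot.SameCycle d d'

namespace PlaneCubicTree

variable {V : Type*} (P : PlaneCubicTree V)

/-- The permutation of the darts that follows the border of the region on the left of a dart:
at the end of `d`, turn left. -/
def turnLeft : Equiv.Perm P.graph.Dart where
  toFun d := P.rot.symm d.symm
  invFun d := (P.rot d).symm
  left_inv d := by simp
  right_inv d := by simp

/-- The regions of the plane cut out by the tree: each region is given by the darts that have it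
on their left, and these darts form one orbit of `turnLeft`. -/
def Region : Type _ := Quotient (Equiv.Perm.SameCycle.setoid P.turnLeft)

/-- The region on the left of a dart. -/
def left (d : P.graph.Dart) : P.Region := Quotient.mk _ d

/-- The region on the right of a dart. -/
def right (d : P.graph.Dart) : P.Region := P.left d.symm

/-- The region met at the end of a dart: the third region at the vertex `d.snd`, lying between the
left turn and the right turn. It is on the left of the dart that turns right. -/
def ahead (d : P.graph.Dart) : P.Region := P.left (P.rot d.symm)

/-- The region at the start of a dart: the third region at the vertex `d.fst`. -/
def behind (d : P.graph.Dart) : P.Region := P.ahead d.symm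

/-- Two regions are adjacent if they have a common border edge. -/
def Adjacent (A B : P.Region) : Prop := ∃ d, P.left d = A ∧ P.right d = B

end PlaneCubicTree

/-- An (integer) topograph: a plane tree with all vertices of degree `3` and integer labels on the
regions such that, around every edge, the regions `r`, `u` at its two ends and the regions `s`, `t`
on its two sides satisfy `r + u = 2 (s + t)`. -/
structure Topograph (V : Type*) extends PlaneCubicTree V where
  /-- the region labels -/
  label : toPlaneCubicTree.Region → ℤ
  progression : ∀ d, label (toPlaneCubicTree.behind d) + label (toPlaneCubicTree.ahead d) =
    2 * (label (toPlaneCubicTree.left d) + label (toPlaneCubicTree.right d))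

namespace Topograph

variable {V : Type*} (T : Topograph V)

/-- The label of a directed edge: the common difference of the arithmetic progression
`r, s + t, u`, where `r` is behind, `u` is ahead, and `s`, `t` are on the two sides. -/
def edgeLabel (d : T.graph.Dart) : ℤ :=
  T.label (T.ahead d) - (T.label (T.left d) + T.label (T.right d))

/-- `D` is the discriminant of the topograph: `D = -ef - fg - ge` at every vertex, where `e, f, g`
are the labels of the three edges directed away from that vertex. -/
def HasDiscriminant (D : ℤ) : Prop :=
  ∀ d : T.graph.Dart,
    D = -(T.edgeLabel d * T.edgeLabel (T.rot d)) -
      T.edgeLabel (T.rot d) * T.edgeLabel (T.rot (T.rot d)) -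
      T.edgeLabel (T.rot (T.rot d)) * T.edgeLabel d

/-- A lake is a region with label `0`. -/
def IsLakeRegion (A : T.Region) : Prop := T.label A = 0

/-- A vertex is on a lake if one of the three regions around it is a lake. (The region on the left
of an outgoing dart lies between this dart and the next one counterclockwise.) -/
def IsLakeVertex (v : V) : Prop := ∃ d : T.graph.Dart, d.fst = v ∧ T.IsLakeRegion (T.left d)

/-- All labels of the regions adjacent to the region `A` are congruent to `r` modulo `m`. -/
def AdjacentResidue (m : ℕ) (A : T.Region) (r : ℤ) : Prop :=
  ∀ B, T.Adjacent A B → T.label B ≡ r [ZMOD m]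

open Classical in
/-- The edge labels after relabeling: river edges, which separate a positive region from a negative
one, get the label `δ` when directed rightwards, that is with the positive region on the left (the
positive regions are drawn above the river), hence `-δ` when directed leftwards. All other edges
keep their labels. -/
noncomputable def starLabel (δ : ℝ) (d : T.graph.Dart) : ℝ :=
  if 0 < T.label (T.left d) ∧ T.label (T.right d) < 0 then δ
  else if T.label (T.left d) < 0 ∧ 0 < T.label (T.right d) then -δ
  else (T.edgeLabel d : ℝ)

/-- The term `1 / |e f g|` of a vertex, where `e, f, g` are the relabeled labels of the three edges
directed away from it. -/
noncomputable def vertexTerm (δ : ℝ) (v : V) : ℝ :=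
  1 / |∏ᶠ d : {d : T.graph.Dart // d.fst = v}, T.starLabel δ d.1|

end Topograph

/-- The function `W₁(x) = 2 Re ∫₀^∞ y / (y² + 1) · 1 / (exp (π (y + 2 i x)) - 1) dy`. -/
noncomputable def W₁ (x : ℝ) : ℝ :=
  2 * (∫ y in Set.Ioi (0 : ℝ), (((y / (y ^ 2 + 1) : ℝ)) : ℂ) *
    (1 / (Complex.exp (Real.pi * (y + 2 * Complex.I * x)) - 1))).re

/-! Around a directed edge with label `e` between regions `s` and `t` one has `e² - 4st = m²`, so
the labels are those of the binary quadratic form `s x² + e x y + t y²`. Its discriminant is a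
square, hence it splits into two linear factors, and their zeros are the two lakes.

The sum is cut into trees. Let `s, t, e > 0` and let `f = e + 2s`, `g = e + 2t` be the next two edge
labels. Then `m³/(efg) = m/f + m/g - m/e`, and `arcoth (e/m) = arcoth (f/m) + arcoth (g/m)`. Both
sides of the recursion therefore telescope, and the vertices ahead of the edge contribute exactly
`arcoth (e/m) - m/e` (`IsUp.total_eq`); there is no loss at infinity because edge labels grow at
every turn.

Around a lake the adjacent labels form a progression of difference `m`. The trees hanging on its
positive labels `c, c + m, ...` sum to `lakeSum (c/m)`, and the negative side gives `lakeSum (1 -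
c/m)`. Their total is expressed by `W₁` in `lakeSum_add_lakeSum`, where the partial fraction
expansion of the cotangent is integrated against `y/(y² + 1)`.

If the lakes are not adjacent, a finite river joins them. Following it is the subtractive Euclidean
algorithm. Each river vertex contributes `m/f`, which cancels the `-m/f` of the tree branching off
there, so only logarithms remain, and they telescope along the river (`exists_river_end`). The
logarithms from the river and from the two lakes combine to `2 log (m/(2 gcd))`. If the lakes are
adjacent there is no river, and the sum is `4 * lakeSum 1`; the boundary case `x = 0` of the
cotangent computation yields the additional `2`. -/

namespace PlaneCubicTree

variable {V : Type*} (P : PlaneCubicTree V)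

/-! ### Turns and non-backtracking trails in a plane cubic tree. -/

theorem fst_rot_symm (d : P.graph.Dart) : (P.rot.symm d).fst = d.fst := by
  rw [← P.rot_fst (P.rot.symm d), Equiv.apply_symm_apply]

theorem finite_darts_from (v : V) : {d : P.graph.Dart | d.fst = v}.Finite := by
  have hfin : (P.graph.neighborSet v).Finite :=
    Set.finite_of_ncard_ne_zero (by rw [P.degree_three]; norm_num)
  refine Set.Finite.of_finite_image (f := fun d : P.graph.Dart => d.snd)
    (hfin.subset ?_) ?_
  · rintro _ ⟨d, hd, rfl⟩
    have h := d.adj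
    rw [Set.mem_ofPred_eq] at hd
    rw [hd] at h
    exact h
  · intro a ha b hb hab
    exact SimpleGraph.Dart.ext _ _ (Prod.ext (ha.trans hb.symm) hab)

theorem ncard_darts_from (v : V) : {d : P.graph.Dart | d.fst = v}.ncard = 3 := by
  rw [← P.degree_three v]
  refine Set.ncard_congr (fun d _ => d.snd) ?_ ?_ ?_
  · intro d hd
    have h := d.adj
    rw [Set.mem_ofPred_eq] at hd
    rw [hd] at h
    exact h
  · intro a b ha hb hab
    exact SimpleGraph.Dart.ext _ _ (Prod.ext (ha.trans hb.symm) hab)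
  · intro w hw
    exact ⟨⟨(v, w), hw⟩, rfl, rfl⟩

theorem isCycleOn_rot (v : V) :
    P.rot.IsCycleOn ((P.finite_darts_from v).toFinset : Set P.graph.Dart) := by
  simp only [Set.Finite.coe_toFinset]
  refine ⟨⟨fun d hd => ?_, P.rot.injective.injOn, fun d hd => ?_⟩, fun a ha b hb => ?_⟩
  · exact (P.rot_fst d).trans hd
  · exact ⟨P.rot.symm d, (P.fst_rot_symm d).trans hd, by simp⟩
  · exact P.rot_cyclic a b (ha.trans hb.symm)

theorem card_darts_from (v : V) : (P.finite_darts_from v).toFinset.card = 3 := by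
  rw [← Set.ncard_eq_toFinset_card _ (P.finite_darts_from v), P.ncard_darts_from]

/-- The three darts at a vertex form a single cycle of `rot`. -/
theorem rot_rot_rot (d : P.graph.Dart) : P.rot (P.rot (P.rot d)) = d := by
  have h := (P.isCycleOn_rot d.fst).pow_card_apply (a := d) (by simp)
  rwa [P.card_darts_from] at h

theorem rot_ne (d : P.graph.Dart) : P.rot d ≠ d := by
  intro h
  have := ((P.isCycleOn_rot d.fst).pow_apply_eq (a := d) (by simp) (n := 1)).1 (by simpa using h)
  rw [P.card_darts_from] at this
  omega

theorem rot_rot_ne (d : P.graph.Dart) : P.rot (P.rot d) ≠ d := by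
  intro h
  have h3 := P.rot_rot_rot d
  rw [h] at h3
  exact P.rot_ne d h3

theorem rot_symm_eq (d : P.graph.Dart) : P.rot.symm d = P.rot (P.rot d) := by
  rw [Equiv.symm_apply_eq, P.rot_rot_rot]

theorem eq_or_of_fst_eq (d d' : P.graph.Dart) (h : d'.fst = d.fst) :
    d' = d ∨ d' = P.rot d ∨ d' = P.rot (P.rot d) := by
  obtain ⟨n, hn, he⟩ := (P.isCycleOn_rot d.fst).exists_pow_eq (a := d) (b := d') (by simp)
    (by simpa using h)
  rw [P.card_darts_from] at hn
  interval_cases n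
  · exact Or.inl he.symm
  · exact Or.inr (Or.inl he.symm)
  · exact Or.inr (Or.inr he.symm)

/-- The dart that turns right at the end of `d`. -/
def turnRight (d : P.graph.Dart) : P.graph.Dart := P.rot d.symm

theorem turnLeft_apply (d : P.graph.Dart) : P.turnLeft d = P.rot (P.rot d.symm) :=
  P.rot_symm_eq _

theorem fst_turnLeft (d : P.graph.Dart) : (P.turnLeft d).fst = d.snd := by
  rw [turnLeft_apply, P.rot_fst, P.rot_fst]; rfl

theorem fst_turnRight (d : P.graph.Dart) : (P.turnRight d).fst = d.snd := by
  rw [turnRight, P.rot_fst]; rfl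

theorem left_turnLeft (d : P.graph.Dart) : P.left (P.turnLeft d) = P.left d :=
  Quotient.sound (show P.turnLeft.SameCycle _ _ from
    Equiv.Perm.sameCycle_apply_left.2 (Equiv.Perm.SameCycle.refl _ _))

theorem left_symm_rot (d : P.graph.Dart) : P.left (P.rot d).symm = P.left d := by
  rw [← P.left_turnLeft (P.rot d).symm]
  congr 1
  exact P.turnLeft.apply_symm_apply d

theorem left_turnRight (d : P.graph.Dart) : P.left (P.turnRight d) = P.ahead d := rfl

theorem right_turnRight (d : P.graph.Dart) : P.right (P.turnRight d) = P.right d :=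
  P.left_symm_rot _

theorem right_turnLeft (d : P.graph.Dart) : P.right (P.turnLeft d) = P.ahead d := by
  rw [turnLeft_apply]
  exact P.left_symm_rot _

theorem left_symm (d : P.graph.Dart) : P.left d.symm = P.right d := rfl

theorem right_symm (d : P.graph.Dart) : P.right d.symm = P.left d := by
  rw [right, SimpleGraph.Dart.symm_symm]

theorem behind_eq (d : P.graph.Dart) : P.behind d = P.left (P.rot d) := by
  rw [behind, ahead, SimpleGraph.Dart.symm_symm]

theorem behind_turnLeft (d : P.graph.Dart) : P.behind (P.turnLeft d) = P.right d := by
  rw [behind_eq, turnLeft_apply, P.rot_rot_rot]; rfl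

theorem behind_turnRight (d : P.graph.Dart) : P.behind (P.turnRight d) = P.left d := by
  rw [behind_eq, turnRight, ← turnLeft_apply, left_turnLeft]

/-- Turn right (`false`) or left (`true`) at the end of a dart. -/
def turn (b : Bool) (d : P.graph.Dart) : P.graph.Dart :=
  if b then P.turnLeft d else P.turnRight d

theorem fst_turn (b : Bool) (d : P.graph.Dart) : (P.turn b d).fst = d.snd := by
  cases b
  · exact P.fst_turnRight d
  · exact P.fst_turnLeft d

theorem turn_ne_symm (b : Bool) (d : P.graph.Dart) : P.turn b d ≠ d.symm := by
  cases b
  · exact P.rot_ne _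
  · simpa [turn, turnLeft_apply] using P.rot_rot_ne d.symm

theorem turn_injective (d : P.graph.Dart) : Function.Injective (fun b => P.turn b d) := by
  have h : P.turnLeft d ≠ P.turnRight d := by
    rw [turnLeft_apply]
    exact P.rot_ne _
  intro b c hbc
  cases b <;> cases c
  · rfl
  · exact absurd hbc.symm h
  · exact absurd hbc h
  · rfl

theorem eq_symm_or_turn (d d' : P.graph.Dart) (h : d'.fst = d.snd) :
    d' = d.symm ∨ ∃ b, d' = P.turn b d := by
  rcases P.eq_or_of_fst_eq d.symm d' h with h | h | h
  · exact Or.inl h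
  · exact Or.inr ⟨false, h⟩
  · exact Or.inr ⟨true, h.trans (P.turnLeft_apply d).symm⟩

/-- The dart reached from `d` after a sequence of turns. -/
def follow (d : P.graph.Dart) : List Bool → P.graph.Dart
  | [] => d
  | b :: w => follow (P.turn b d) w

/-- The darts run through by `follow`. -/
def trail (d : P.graph.Dart) : List Bool → List P.graph.Dart
  | [] => [d]
  | b :: w => d :: trail (P.turn b d) w

theorem follow_append_singleton (d : P.graph.Dart) (w : List Bool) (b : Bool) :
    P.follow d (w ++ [b]) = P.turn b (P.follow d w) := by
  induction w generalizing d with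
  | nil => rfl
  | cons c w ih => exact ih _

theorem trail_head (d : P.graph.Dart) (w : List Bool) : ∃ l, P.trail d w = d :: l := by
  cases w <;> exact ⟨_, rfl⟩

theorem trail_inj {d d' : P.graph.Dart} {w w' : List Bool} (h : P.trail d w = P.trail d' w') :
    d = d' ∧ w = w' := by
  have hd : d = d' := by
    obtain ⟨l, hl⟩ := P.trail_head d w
    obtain ⟨l', hl'⟩ := P.trail_head d' w'
    rw [hl, hl'] at h
    exact (List.cons.inj h).1
  subst hd
  refine ⟨rfl, ?_⟩
  induction w generalizing d w' with
  | nil =>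
    cases w' with
    | nil => rfl
    | cons b w' =>
      obtain ⟨l, hl⟩ := P.trail_head (P.turn b d) w'
      simp [trail, hl] at h
  | cons b w ih =>
    cases w' with
    | nil =>
      obtain ⟨l, hl⟩ := P.trail_head (P.turn b d) w
      simp [trail, hl] at h
    | cons c w' =>
      have h2 := (List.cons.inj h).2
      obtain ⟨l, hl⟩ := P.trail_head (P.turn b d) w
      obtain ⟨l', hl'⟩ := P.trail_head (P.turn c d) w'
      have hbc : P.turn b d = P.turn c d := by
        have h3 := h2
        rw [hl, hl'] at h3
        exact (List.cons.inj h3).1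
      obtain rfl : b = c := P.turn_injective d hbc
      rw [ih h2]

theorem edge_turn_ne (b : Bool) (d : P.graph.Dart) : d.edge ≠ (P.turn b d).edge := by
  intro h
  rcases (SimpleGraph.dart_edge_eq_iff _ _).1 h with h | h
  · have := P.fst_turn b d
    rw [← h] at this
    exact d.fst_ne_snd this
  · have h2 := congrArg SimpleGraph.Dart.symm h
    rw [SimpleGraph.Dart.symm_symm] at h2
    exact P.turn_ne_symm b d h2.symm

theorem isChain_trail (d : P.graph.Dart) (w : List Bool) :
    List.IsChain (· ≠ ·) ((P.trail d w).map SimpleGraph.Dart.edge) := by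
  induction w generalizing d with
  | nil => simp [trail]
  | cons b w ih =>
    have h := ih (P.turn b d)
    obtain ⟨l, hl⟩ := P.trail_head (P.turn b d) w
    rw [trail]
    rw [hl] at h ⊢
    simp only [List.map_cons] at h ⊢
    exact List.IsChain.cons_cons (P.edge_turn_ne b d) h

theorem exists_walk_darts_eq_trail (d : P.graph.Dart) (w : List Bool) (u : V) (hu : d.fst = u) :
    ∃ p : P.graph.Walk u (P.follow d w).snd, p.darts = P.trail d w := by
  induction w generalizing d u with
  | nil => subst hu; exact ⟨SimpleGraph.Walk.cons d.adj .nil, rfl⟩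
  | cons b w ih =>
    subst hu
    obtain ⟨p, hp⟩ := ih (P.turn b d) d.snd (P.fst_turn b d)
    refine ⟨SimpleGraph.Walk.cons d.adj p, ?_⟩
    change d :: p.darts = d :: P.trail (P.turn b d) w
    rw [hp]

/-- A turn never goes back along the same edge, and in an acyclic graph a walk whose consecutive
edges differ is a path. Uniqueness of paths then makes turn words faithful coordinates of vertices.
-/
theorem exists_path_darts_eq_trail (d : P.graph.Dart) (w : List Bool) (u v : V) (hu : d.fst = u)
    (hv : (P.follow d w).snd = v) :
    ∃ p : P.graph.Walk u v, p.IsPath ∧ p.darts = P.trail d w := by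
  subst hv
  obtain ⟨p, hp⟩ := P.exists_walk_darts_eq_trail d w u hu
  refine ⟨p, (P.isTree.isAcyclic.isPath_iff_isChain p).2 ?_, hp⟩
  rw [SimpleGraph.Walk.edges, hp]
  exact P.isChain_trail d w

theorem follow_snd_inj {d d' : P.graph.Dart} {w w' : List Bool} (hd : d.fst = d'.fst)
    (h : (P.follow d w).snd = (P.follow d' w').snd) : d = d' ∧ w = w' := by
  obtain ⟨p, hp, hpd⟩ := P.exists_path_darts_eq_trail d w _ _ hd rfl
  obtain ⟨q, hq, hqd⟩ := P.exists_path_darts_eq_trail d' w' _ _ rfl h.symm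
  have hpq : p = q :=
    congrArg Subtype.val ((P.isTree.isAcyclic.subsingleton_path _ _).elim ⟨p, hp⟩ ⟨q, hq⟩)
  exact P.trail_inj (by rw [← hpd, hpq, hqd])

theorem follow_snd_ne_fst (d : P.graph.Dart) (w : List Bool) : (P.follow d w).snd ≠ d.fst := by
  intro h
  obtain ⟨p, hp, hpd⟩ := P.exists_path_darts_eq_trail d w _ _ rfl h
  have hnil : p = SimpleGraph.Walk.nil :=
    congrArg Subtype.val ((P.isTree.isAcyclic.subsingleton_path _ _).elim ⟨p, hp⟩ ⟨.nil, .nil⟩)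
  obtain ⟨l, hl⟩ := P.trail_head d w
  rw [hnil, hl] at hpd
  simp at hpd

/-- The dart reached by a sequence of turns that starts with `d` or with the opposite of `d`. -/
def reach (d : P.graph.Dart) : List Bool ⊕ List Bool → P.graph.Dart :=
  Sum.elim (P.follow d) (P.follow d.symm)

/-- The two halves cut out by the edge of `d` are disjoint: a vertex behind it is either `d.fst` or
is reached from `d.fst` through a first dart different from `d`. -/
theorem reach_snd_injective (d : P.graph.Dart) : Function.Injective fun x => (P.reach d x).snd := by
  have key : ∀ (d : P.graph.Dart) (w w' : List Bool),
      (P.follow d w).snd ≠ (P.follow d.symm w').snd := by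
    intro d w w' h
    cases w' with
    | nil => exact P.follow_snd_ne_fst d w h
    | cons b w' =>
      have := P.follow_snd_inj (d := d) (d' := P.turn b d.symm) (w := w) (w' := w')
        (by rw [fst_turn]; rfl) h
      exact P.turn_ne_symm b d.symm (by rw [← this.1, SimpleGraph.Dart.symm_symm])
  rintro (w | w) (w' | w') h
  · rw [(P.follow_snd_inj rfl h).2]
  · exact absurd h (key d w w')
  · exact absurd h.symm (key d w' w)
  · rw [(P.follow_snd_inj rfl h).2]

theorem exists_reach_snd_of_fst (d x : P.graph.Dart) (h : ∃ y, (P.reach d y).snd = x.fst) :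
    (∃ y, P.reach d y = x) ∨ ∃ y, P.reach d y = x.symm := by
  obtain ⟨y, hy⟩ := h
  rcases P.eq_symm_or_turn (P.reach d y) x hy.symm with h | ⟨b, h⟩
  · exact Or.inr ⟨y, by rw [h, SimpleGraph.Dart.symm_symm]⟩
  · left
    rcases y with w | w
    · exact ⟨.inl (w ++ [b]), by rw [h]; exact P.follow_append_singleton _ _ _⟩
    · exact ⟨.inr (w ++ [b]), by rw [h]; exact P.follow_append_singleton _ _ _⟩

theorem exists_fst_eq_reach_snd (d : P.graph.Dart) (y : List Bool ⊕ List Bool) :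
    ∃ z, (P.reach d z).snd = (P.reach d y).fst := by
  rcases y with w | w <;> rcases List.eq_nil_or_concat w with rfl | ⟨w, b, rfl⟩
  · exact ⟨.inr [], rfl⟩
  · refine ⟨.inl w, ?_⟩
    simp only [reach, Sum.elim_inl, List.concat_eq_append, follow_append_singleton, fst_turn]
  · exact ⟨.inl [], rfl⟩
  · refine ⟨.inr w, ?_⟩
    simp only [reach, Sum.elim_inr, List.concat_eq_append, follow_append_singleton, fst_turn]

theorem reach_snd_surjective (d : P.graph.Dart) :
    Function.Surjective fun x => (P.reach d x).snd := by
  intro v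
  obtain ⟨p⟩ := P.isTree.connected.preconnected d.snd v
  have key : ∀ {u v : V} (_ : P.graph.Walk u v), (∃ y, (P.reach d y).snd = u) →
      ∃ y, (P.reach d y).snd = v := by
    intro u v p
    induction p with
    | nil => exact id
    | cons h p ih =>
      rename_i u v w
      intro hu
      apply ih
      rcases P.exists_reach_snd_of_fst d ⟨(u, v), h⟩ hu with ⟨y, hy⟩ | ⟨y, hy⟩
      · exact ⟨y, by rw [hy]⟩
      · obtain ⟨z, hz⟩ := P.exists_fst_eq_reach_snd d y
        exact ⟨z, by rw [hz, hy]; rfl⟩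
  exact key p ⟨.inl [], rfl⟩

theorem exists_reach_eq_or_symm (d x : P.graph.Dart) :
    (∃ y, P.reach d y = x) ∨ ∃ y, P.reach d y = x.symm :=
  P.exists_reach_snd_of_fst d x (P.reach_snd_surjective d x.fst)

/-- The vertices are numbered by the sequences of turns that start at a given dart or at its
opposite. -/
noncomputable def vertexEquiv (d : P.graph.Dart) : List Bool ⊕ List Bool ≃ V :=
  Equiv.ofBijective _ ⟨P.reach_snd_injective d, P.reach_snd_surjective d⟩

end PlaneCubicTree

/-! ### Sums over binary trees of edge states. -/

/-- The labels around a directed edge: the region on the left, the region on the right and the edge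
itself. -/
@[ext]
structure EdgeState where
  left : ℤ
  right : ℤ
  edge : ℤ

namespace EdgeState

/-- The labels around the edge that turns right (`false`) or left (`true`). -/
def turn (b : Bool) (x : EdgeState) : EdgeState :=
  if b then ⟨x.left, x.left + x.right + x.edge, x.edge + 2 * x.left⟩
  else ⟨x.left + x.right + x.edge, x.right, x.edge + 2 * x.right⟩

/-- The labels around the edge reached by a sequence of turns. -/
def follow (x : EdgeState) : List Bool → EdgeState
  | [] => x
  | b :: w => follow (x.turn b) w

/-- Reflection in the edge. -/
def mirror (x : EdgeState) : EdgeState := ⟨x.right, x.left, x.edge⟩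

/-- Change of all signs. -/
def neg (x : EdgeState) : EdgeState := ⟨-x.left, -x.right, -x.edge⟩

/-- Reflection and change of sign commute with turning up to exchange of left and right. All totals
are invariant under both, so only one sign and one side need be computed. -/
theorem turn_mirror (b : Bool) (x : EdgeState) : x.mirror.turn b = (x.turn (!b)).mirror := by
  cases b <;> ext <;> simp [turn, mirror] <;> ring

theorem turn_neg (b : Bool) (x : EdgeState) : x.neg.turn b = (x.turn b).neg := by
  cases b <;> ext <;> simp [turn, neg] <;> ring

/-- The absolute value of the label of the edge after relabelling of the river edges. -/
noncomputable def starAbs (m : ℝ) (x : EdgeState) : ℝ :=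
  if x.left * x.right < 0 then m else |(x.edge : ℝ)|

theorem starAbs_mirror (m : ℝ) (x : EdgeState) : x.mirror.starAbs m = x.starAbs m := by
  simp [starAbs, mirror, mul_comm]

theorem starAbs_neg (m : ℝ) (x : EdgeState) : x.neg.starAbs m = x.starAbs m := by
  simp [starAbs, neg]

/-- The contribution of the end of an edge to the sum over the vertices not on a lake, scaled by
`m ^ 3`. -/
noncomputable def term (m : ℝ) (x : EdgeState) : ENNReal :=
  if x.left = 0 ∨ x.right = 0 ∨ x.left + x.right + x.edge = 0 then 0
  else ENNReal.ofReal (m ^ 3 * (1 / (x.starAbs m * (x.turn true).starAbs m *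
    (x.turn false).starAbs m)))

theorem term_mirror (m : ℝ) (x : EdgeState) : x.mirror.term m = x.term m := by
  unfold term
  rw [turn_mirror, turn_mirror, starAbs_mirror, starAbs_mirror, starAbs_mirror]
  have h : x.starAbs m * (x.turn !true).starAbs m * (x.turn !false).starAbs m =
      x.starAbs m * (x.turn true).starAbs m * (x.turn false).starAbs m := by
    simp only [Bool.not_true, Bool.not_false]
    ring
  rw [h]
  congr 1
  simp only [mirror, add_comm x.right x.left, eq_iff_iff]
  tauto

theorem term_neg (m : ℝ) (x : EdgeState) : x.neg.term m = x.term m := by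
  unfold term
  rw [turn_neg, turn_neg, starAbs_neg, starAbs_neg, starAbs_neg]
  congr 1
  simp only [neg, neg_eq_zero, eq_iff_iff]
  have : -x.left + -x.right + -x.edge = 0 ↔ x.left + x.right + x.edge = 0 := by
    constructor <;> intro h <;> linarith
  rw [this]

/-- The sum of the contributions of all vertices ahead of an edge. -/
noncomputable def total (m : ℝ) (x : EdgeState) : ENNReal :=
  ∑' w : List Bool, (x.follow w).term m

/-- The sum of the contributions of the vertices ahead of an edge that are reached by less than `n`
turns. -/
noncomputable def partialTotal (m : ℝ) : ℕ → EdgeState → ENNReal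
  | 0, _ => 0
  | n + 1, x => x.term m + partialTotal m n (x.turn true) + partialTotal m n (x.turn false)

end EdgeState

theorem ENNReal.tsum_list_bool (f : List Bool → ENNReal) :
    ∑' w, f w = f [] + ∑' w, f (true :: w) + ∑' w, f (false :: w) := by
  let e : Unit ⊕ (List Bool ⊕ List Bool) ≃ List Bool :=
    { toFun := Sum.elim (fun _ => []) (Sum.elim (List.cons true) (List.cons false))
      invFun := fun w => match w with
        | [] => .inl ()
        | true :: w => .inr (.inl w)
        | false :: w => .inr (.inr w)
      left_inv := by rintro (_ | _ | _) <;> rfl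
      right_inv := by rintro (_ | ⟨_ | _, _⟩) <;> rfl }
  rw [← e.tsum_eq f, Summable.tsum_sum ENNReal.summable ENNReal.summable,
    Summable.tsum_sum ENNReal.summable ENNReal.summable, tsum_fintype, Fintype.sum_unique,
    ← add_assoc]
  rfl

namespace EdgeState

theorem total_eq (m : ℝ) (x : EdgeState) :
    x.total m = x.term m + (x.turn true).total m + (x.turn false).total m :=
  ENNReal.tsum_list_bool _

theorem partialTotal_eq_tsum (m : ℝ) (n : ℕ) (x : EdgeState) :
    partialTotal m n x = ∑' w : List Bool, if w.length < n then (x.follow w).term m else 0 := by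
  induction n generalizing x with
  | zero => simp [partialTotal]
  | succ n ih =>
    rw [ENNReal.tsum_list_bool, partialTotal, ih, ih]
    simp [follow]

/-- Every finite set of words has bounded length, so it is covered by one truncation. -/
theorem total_le_of_partialTotal_le {m : ℝ} {x : EdgeState} {c : ENNReal}
    (h : ∀ n, partialTotal m n x ≤ c) : x.total m ≤ c := by
  rw [total, ENNReal.tsum_eq_iSup_sum]
  refine iSup_le fun s => ?_
  refine le_trans ?_ (h ((s.sup List.length) + 1))
  rw [partialTotal_eq_tsum]
  refine le_trans (Finset.sum_le_sum fun w hw => ?_) (ENNReal.sum_le_tsum s)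
  have : w.length ≤ s.sup List.length := Finset.le_sup (f := List.length) hw
  rw [if_pos (by omega)]

theorem follow_mirror (x : EdgeState) (w : List Bool) :
    x.mirror.follow w = (x.follow (w.map not)).mirror := by
  induction w generalizing x with
  | nil => rfl
  | cons b w ih => rw [follow, turn_mirror, ih]; rfl

theorem follow_neg (x : EdgeState) (w : List Bool) : x.neg.follow w = (x.follow w).neg := by
  induction w generalizing x with
  | nil => rfl
  | cons b w ih => rw [follow, turn_neg, ih]; rfl

theorem total_neg (m : ℝ) (x : EdgeState) : x.neg.total m = x.total m :=
  tsum_congr fun w => by rw [follow_neg, term_neg]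

theorem total_mirror (m : ℝ) (x : EdgeState) : x.mirror.total m = x.total m := by
  let e : List Bool ≃ List Bool :=
    Function.Involutive.toPerm (List.map not) fun w => by simp [List.map_map, Function.comp_def]
  rw [total, total, ← e.tsum_eq fun w => (x.follow w).term m]
  exact tsum_congr fun w => by rw [follow_mirror, term_mirror]; rfl

end EdgeState

/-! ### The telescoping identities and trees with positive labels. -/

/-- The function `e ↦ arcoth (e / m)`. -/
noncomputable def arcothDiv (m e : ℝ) : ℝ := Real.log ((e + m) / (e - m)) / 2

/-- `m / e` is the first term of the series of `artanh` at `m / e`, and all terms are nonnegative.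
-/
theorem div_le_arcothDiv {m e : ℝ} (hm : 0 < m) (he : m < e) : m / e ≤ arcothDiv m e := by
  have he0 : 0 < e := hm.trans he
  have hx0 : 0 < m / e := div_pos hm he0
  have hx1 : m / e < 1 := (div_lt_one he0).2 he
  have h := Real.hasSum_log_sub_log_of_abs_lt_one (x := m / e) (by rwa [abs_of_pos hx0])
  have h1 := le_hasSum h 0 fun k _ => by positivity
  have h2 : Real.log ((e + m) / (e - m)) = Real.log (1 + m / e) - Real.log (1 - m / e) := by
    rw [← Real.log_div (by positivity) (by linarith)]
    congr 1
    have : e - m ≠ 0 := by linarith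
    have h3 : 1 - m / e ≠ 0 := by linarith
    field_simp
  rw [arcothDiv, h2]
  norm_num at h1
  linarith

/-- This controls the remainder of the tree sum: it is a small multiple of `arcothDiv`, which is
additive over the branches, so errors do not accumulate with the number of branches. -/
theorem arcothDiv_sub_le {m e : ℝ} (hm : 0 < m) (he : m < e) :
    arcothDiv m e - m / e ≤ m / e * arcothDiv m e := by
  have he0 : 0 < e := hm.trans he
  have hem : 0 < e - m := by linarith
  have h1 : Real.log ((e + m) / (e - m)) ≤ (e + m) / (e - m) - 1 :=
    Real.log_le_sub_one_of_pos (by positivity)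
  have h2 : arcothDiv m e ≤ m / (e - m) := by
    rw [arcothDiv]
    have : (e + m) / (e - m) - 1 = 2 * (m / (e - m)) := by field_simp; ring
    linarith
  have h3 : (1 - m / e) * arcothDiv m e ≤ (1 - m / e) * (m / (e - m)) :=
    mul_le_mul_of_nonneg_left h2 (by rw [sub_nonneg]; exact ((div_lt_one he0).2 he).le)
  have h4 : (1 - m / e) * (m / (e - m)) = m / e := by field_simp
  linarith

theorem arcothDiv_nonneg {m e : ℝ} (hm : 0 < m) (he : m < e) : 0 ≤ arcothDiv m e :=
  (div_nonneg hm.le (hm.trans he).le).trans (div_le_arcothDiv hm he)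

theorem arcothDiv_add {m s t e : ℝ} (hm : 0 < m) (hs : 0 < s) (ht : 0 < t) (he : m < e)
    (hD : e ^ 2 - 4 * s * t = m ^ 2) :
    arcothDiv m e = arcothDiv m (e + 2 * s) + arcothDiv m (e + 2 * t) := by
  have h1 : (e + m) / (e - m) =
      ((e + 2 * s + m) / (e + 2 * s - m)) * ((e + 2 * t + m) / (e + 2 * t - m)) := by
    have h1 : e - m ≠ 0 := by linarith
    have h2 : e + 2 * s - m ≠ 0 := by linarith
    have h3 : e + 2 * t - m ≠ 0 := by linarith
    field_simp
    linear_combination (-2 * m) * hD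
  have h2 : 0 < e + 2 * s - m := by linarith
  have h3 : 0 < e + 2 * t - m := by linarith
  have h4 : 0 < e := hm.trans he
  rw [arcothDiv, h1, Real.log_mul (by positivity) (by positivity), arcothDiv, arcothDiv, add_div]

theorem cube_div_eq {m s t e : ℝ} (hs : 0 < s) (ht : 0 < t) (he : 0 < e)
    (hD : e ^ 2 - 4 * s * t = m ^ 2) :
    m ^ 3 * (1 / (e * (e + 2 * s) * (e + 2 * t))) =
      m / (e + 2 * s) + m / (e + 2 * t) - m / e := by
  field_simp
  linear_combination (-m) * hD

namespace EdgeState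

/-- All regions ahead of the edge are positive. -/
structure IsUp (m : ℝ) (x : EdgeState) : Prop where
  left_pos : 0 < x.left
  right_pos : 0 < x.right
  edge_pos : 0 < x.edge
  disc : (x.edge : ℝ) ^ 2 - 4 * x.left * x.right = m ^ 2

theorem IsUp.lt {m : ℝ} {x : EdgeState} (h : x.IsUp m) : m < x.edge := by
  have h1 : (0 : ℝ) < x.left := by exact_mod_cast h.left_pos
  have h2 : (0 : ℝ) < x.right := by exact_mod_cast h.right_pos
  have h3 : (0 : ℝ) < x.edge := by exact_mod_cast h.edge_pos
  refine lt_of_pow_lt_pow_left₀ 2 h3.le ?_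
  have := h.disc
  nlinarith [mul_pos h1 h2]

theorem IsUp.turn {m : ℝ} {x : EdgeState} (h : x.IsUp m) (b : Bool) : (x.turn b).IsUp m := by
  obtain ⟨h1, h2, h3, h4⟩ := h
  cases b
  · refine ⟨?_, ?_, ?_, ?_⟩ <;> simp [EdgeState.turn] <;> try omega
    linear_combination h4
  · refine ⟨?_, ?_, ?_, ?_⟩ <;> simp [EdgeState.turn] <;> try omega
    linear_combination h4

theorem IsUp.starAbs {m : ℝ} {x : EdgeState} (h : x.IsUp m) : x.starAbs m = x.edge := by
  have h3 : (0 : ℝ) < x.edge := by exact_mod_cast h.edge_pos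
  rw [EdgeState.starAbs, if_neg (by have := mul_pos h.left_pos h.right_pos; omega), abs_of_pos h3]

/-- The value of the sum over the vertices ahead of an upward edge. -/
noncomputable def upValue (m : ℝ) (x : EdgeState) : ℝ := arcothDiv m x.edge - m / x.edge

theorem IsUp.upValue_nonneg {m : ℝ} (hm : 0 < m) {x : EdgeState} (h : x.IsUp m) :
    0 ≤ x.upValue m := sub_nonneg.2 (div_le_arcothDiv hm h.lt)

theorem IsUp.arcothDiv_eq {m : ℝ} (hm : 0 < m) {x : EdgeState} (h : x.IsUp m) :
    arcothDiv m x.edge =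
      arcothDiv m (x.turn true).edge + arcothDiv m (x.turn false).edge := by
  have h1 : (0 : ℝ) < x.left := by exact_mod_cast h.left_pos
  have h2 : (0 : ℝ) < x.right := by exact_mod_cast h.right_pos
  rw [arcothDiv_add hm h1 h2 h.lt h.disc]
  simp [EdgeState.turn]

theorem IsUp.ofReal_upValue {m : ℝ} (hm : 0 < m) {x : EdgeState} (h : x.IsUp m) :
    ENNReal.ofReal (x.upValue m) = x.term m + ENNReal.ofReal ((x.turn true).upValue m) +
      ENNReal.ofReal ((x.turn false).upValue m) := by
  have h1 : (0 : ℝ) < x.left := by exact_mod_cast h.left_pos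
  have h2 : (0 : ℝ) < x.right := by exact_mod_cast h.right_pos
  have h3 : (0 : ℝ) < x.edge := by exact_mod_cast h.edge_pos
  have hz : ¬ (x.left = 0 ∨ x.right = 0 ∨ x.left + x.right + x.edge = 0) := by
    have := h.left_pos
    have := h.right_pos
    have := h.edge_pos
    omega
  rw [EdgeState.term, if_neg hz, h.starAbs, (h.turn true).starAbs, (h.turn false).starAbs]
  have e1 : (((x.turn true).edge : ℤ) : ℝ) = x.edge + 2 * x.left := by simp [EdgeState.turn]
  have e2 : (((x.turn false).edge : ℤ) : ℝ) = x.edge + 2 * x.right := by simp [EdgeState.turn]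
  rw [← ENNReal.ofReal_add (by rw [e1, e2]; positivity) ((h.turn true).upValue_nonneg hm),
    ← ENNReal.ofReal_add (add_nonneg (by rw [e1, e2]; positivity)
      ((h.turn true).upValue_nonneg hm)) ((h.turn false).upValue_nonneg hm)]
  congr 1
  rw [upValue, upValue, upValue, e1, e2, cube_div_eq h1 h2 h3 h.disc,
    arcothDiv_add hm h1 h2 h.lt h.disc]
  ring

theorem IsUp.partialTotal_le {m : ℝ} (hm : 0 < m) (n : ℕ) {x : EdgeState} (h : x.IsUp m) :
    partialTotal m n x ≤ ENNReal.ofReal (x.upValue m) := by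
  induction n generalizing x with
  | zero => simp [partialTotal]
  | succ n ih =>
    rw [h.ofReal_upValue hm, partialTotal]
    gcongr
    · exact ih (h.turn true)
    · exact ih (h.turn false)

/-- Cut the tree after `n` turns. There all edge labels are at least `m / δ`, so each remaining
branch has value at most `δ` times its `arcothDiv`, and these add up to `δ * arcothDiv m x.edge`. -/
theorem IsUp.upValue_le_add {m : ℝ} (hm : 0 < m) (n : ℕ) {δ : ℝ} (hδ : 0 ≤ δ) {x : EdgeState}
    (h : x.IsUp m) (hn : m ≤ δ * (x.edge + 2 * n)) :
    ENNReal.ofReal (x.upValue m) ≤ x.total m + ENNReal.ofReal (δ * arcothDiv m x.edge) := by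
  induction n generalizing x with
  | zero =>
    refine le_trans (ENNReal.ofReal_le_ofReal ?_) le_add_self
    have h3 : (0 : ℝ) < x.edge := by exact_mod_cast h.edge_pos
    refine (arcothDiv_sub_le hm h.lt).trans ?_
    refine mul_le_mul_of_nonneg_right ?_ (arcothDiv_nonneg hm h.lt)
    rw [div_le_iff₀ h3]
    simpa using hn
  | succ n ih =>
    -- Positive integer labels are at least `1`, so each turn raises the edge label by at least `2`.
    have h1 : (1 : ℝ) ≤ x.left := by exact_mod_cast h.left_pos
    have h2 : (1 : ℝ) ≤ x.right := by exact_mod_cast h.right_pos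
    push_cast at hn
    have i1 := ih (h.turn true) (hn.trans (mul_le_mul_of_nonneg_left
      (by simp [EdgeState.turn]; linarith) hδ))
    have i2 := ih (h.turn false) (hn.trans (mul_le_mul_of_nonneg_left
      (by simp [EdgeState.turn]; linarith) hδ))
    rw [h.ofReal_upValue hm, h.arcothDiv_eq hm, mul_add,
      ENNReal.ofReal_add (mul_nonneg hδ (arcothDiv_nonneg hm (h.turn true).lt))
        (mul_nonneg hδ (arcothDiv_nonneg hm (h.turn false).lt)), total_eq]
    calc _ ≤ x.term m + ((x.turn true).total m + _) + ((x.turn false).total m + _) := by gcongr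
      _ = _ := by ring

theorem IsUp.total_eq {m : ℝ} (hm : 0 < m) {x : EdgeState} (h : x.IsUp m) :
    x.total m = ENNReal.ofReal (x.upValue m) := by
  refine le_antisymm (total_le_of_partialTotal_le fun n => h.partialTotal_le hm n) ?_
  refine ENNReal.le_of_forall_pos_le_add fun ε hε _ => ?_
  have hA := arcothDiv_nonneg hm h.lt
  -- The `+ 1` keeps the denominator positive and gives `δ * arcothDiv m x.edge ≤ ε`.
  set δ : ℝ := ε / (arcothDiv m x.edge + 1) with hδ
  have hε' : (0 : ℝ) < ε := by exact_mod_cast hε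
  have hδ0 : 0 < δ := by positivity
  obtain ⟨n, hn⟩ := exists_nat_ge (m / δ)
  have h3 : (0 : ℝ) < x.edge := by exact_mod_cast h.edge_pos
  refine (h.upValue_le_add hm n hδ0.le ?_).trans ?_
  · rw [div_le_iff₀ hδ0] at hn
    have : (0 : ℝ) ≤ n := n.cast_nonneg
    nlinarith
  · gcongr
    rw [← ENNReal.ofReal_coe_nnreal]
    refine ENNReal.ofReal_le_ofReal ?_
    rw [hδ, div_mul_eq_mul_div, div_le_iff₀ (by positivity)]
    nlinarith

/-- Turning left follows the shore, whose vertices contribute nothing; each right turn leaves the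
lake into a tree with positive labels, whose sum is known. -/
theorem total_lake {m c : ℤ} (hm : 0 < m) (hc : 0 < c) :
    (⟨0, c, m⟩ : EdgeState).total m =
      ∑' k : ℕ, ENNReal.ofReal (upValue m ⟨c + (k + 1) * m, c + k * m, m + 2 * (c + k * m)⟩) := by
  have hmR : (0 : ℝ) < m := by exact_mod_cast hm
  have hL : ∀ c : ℤ, (⟨0, c, m⟩ : EdgeState).turn true = ⟨0, c + m, m⟩ := fun c => by
    simp [EdgeState.turn]
  have hR : ∀ c : ℤ, (⟨0, c, m⟩ : EdgeState).turn false = ⟨c + m, c, m + 2 * c⟩ := fun c => by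
    simp [EdgeState.turn]
  have hup : ∀ k : ℕ, IsUp m ⟨c + (k + 1) * m, c + k * m, m + 2 * (c + k * m)⟩ := by
    intro k
    have : 0 ≤ k * m := by positivity
    refine ⟨by simp only; nlinarith, by simp only; omega, by simp only; omega, ?_⟩
    push_cast
    ring
  have h0 : ∀ c : ℤ, (⟨0, c, m⟩ : EdgeState).term m = 0 := fun c => by simp [EdgeState.term]
  have hk : ∀ k : ℕ, (⟨0, c + k * m, m⟩ : EdgeState).total m =
      ENNReal.ofReal (upValue m ⟨c + (k + 1) * m, c + k * m, m + 2 * (c + k * m)⟩) +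
        (⟨0, c + (k + 1 : ℕ) * m, m⟩ : EdgeState).total m := by
    intro k
    rw [EdgeState.total_eq, h0, hL, hR, zero_add, add_comm, ← (hup k).total_eq hmR]
    have e1 : c + k * m + m = c + (k + 1) * m := by ring
    rw [e1]
    push_cast
    rfl
  apply le_antisymm
  · have key : ∀ (n j : ℕ), partialTotal m n ⟨0, c + j * m, m⟩ ≤
        ∑ k ∈ Finset.range n, ENNReal.ofReal (upValue m
          ⟨c + ((j + k : ℕ) + 1) * m, c + (j + k : ℕ) * m, m + 2 * (c + (j + k : ℕ) * m)⟩) := by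
      intro n
      induction n with
      | zero => intro j; simp [partialTotal]
      | succ n ih =>
        intro j
        rw [partialTotal, h0, hL, hR, zero_add, Finset.sum_range_succ']
        have e1 : c + j * m + m = c + (j + 1 : ℕ) * m := by push_cast; ring
        rw [e1]
        gcongr
        · refine (ih (j + 1)).trans (le_of_eq (Finset.sum_congr rfl fun k _ => ?_))
          rw [show j + 1 + k = j + (k + 1) by ring]
        · have := (hup j).partialTotal_le hmR n
          push_cast
          simpa using this
    refine total_le_of_partialTotal_le fun n => ?_
    have := key n 0
    simp only [Nat.cast_zero, zero_mul, add_zero, zero_add] at this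
    exact this.trans (ENNReal.sum_le_tsum _)
  · rw [ENNReal.tsum_eq_iSup_nat]
    refine iSup_le fun n => ?_
    have key : ∀ n : ℕ, (⟨0, c, m⟩ : EdgeState).total m = ∑ k ∈ Finset.range n, ENNReal.ofReal
        (upValue m ⟨c + (k + 1) * m, c + k * m, m + 2 * (c + k * m)⟩) +
        (⟨0, c + n * m, m⟩ : EdgeState).total m := by
      intro n
      induction n with
      | zero => simp
      | succ n ih => rw [ih, hk, Finset.sum_range_succ, add_assoc]
    rw [key n]
    exact le_self_add

/-! ### Steps along a river. -/

/-- The river edge with labels `a y` and `-b z`. -/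
def river (a b y z : ℤ) : EdgeState := ⟨a * y, -(b * z), a * z - b * y⟩

theorem neg_mirror_river (a b y z : ℤ) : (river a b y z).neg.mirror = river b a z y := by
  ext <;> simp [river, neg, mirror]

theorem total_river_swap (m : ℝ) (a b y z : ℤ) :
    (river a b y z).total m = (river b a z y).total m := by
  rw [← neg_mirror_river, total_mirror, total_neg]

/-- In these coordinates `e² - 4st = (az + by)²`. Staying on the river is a subtractive Euclidean
step on `(a, b)`; it preserves `az + by` and `gcd a b`. -/
theorem turn_false_river (a b y z : ℤ) :
    (river a b y z).turn false = river (a - b) b (y + z) z := by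
  ext <;> simp [river, turn] <;> ring

theorem turn_true_river (a b y z : ℤ) :
    (river a b y z).turn true = ⟨a * y, (a - b) * (y + z), a * z - b * y + 2 * (a * y)⟩ := by
  ext <;> simp [river, turn]
  ring

theorem turn_true_river' (a b y z : ℤ) :
    (river a b y z).turn true = river a (b - a) y (y + z) := by
  ext <;> simp [river, turn] <;> ring

/-- Two of the three edges at the river vertex are relabelled `m`, so the vertex contributes `m /
f`, with `f` the label of the edge leaving the river. This cancels `-m / f` in the value of the tree
beyond, and only `arcoth (f / m)` is left. -/
theorem total_river_of_lt {m : ℝ} {a b y z : ℤ} (hb : 0 < b) (hy : 0 < y) (hz : 0 < z)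
    (hab : b < a) (hm : (a * z + b * y : ℝ) = m) :
    (river a b y z).total m =
      ENNReal.ofReal (Real.log ((a * (y + z)) / (y * (a - b) : ℝ)) / 2) +
        (river (a - b) b (y + z) z).total m := by
  have hb' : (0 : ℝ) < b := by exact_mod_cast hb
  have hy' : (0 : ℝ) < y := by exact_mod_cast hy
  have hz' : (0 : ℝ) < z := by exact_mod_cast hz
  have hab' : (b : ℝ) < a := by exact_mod_cast hab
  have ha' : (0 : ℝ) < a := hb'.trans hab'
  have hm0 : 0 < m := by rw [← hm]; positivity
  have ha : 0 < a := hb.trans hab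
  have hup : ((river a b y z).turn true).IsUp m := by
    rw [turn_true_river]
    refine ⟨by positivity, mul_pos (by omega) (by omega), ?_, ?_⟩
    · simp only
      nlinarith [mul_pos ha hz, mul_pos ha hy, mul_pos (sub_pos.2 hab) hy]
    · push_cast
      rw [← hm]
      ring
  have s1 : (river a b y z).starAbs m = m := by
    rw [starAbs, if_pos]
    have := mul_pos (mul_pos ha hy) (mul_pos hb hz)
    simp only [river]
    nlinarith
  have s2 : ((river a b y z).turn false).starAbs m = m := by
    rw [starAbs, if_pos]
    rw [turn_false_river]
    have := mul_pos (mul_pos (sub_pos.2 hab) (add_pos hy hz)) (mul_pos hb hz)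
    simp only [river]
    nlinarith
  have he : (0 : ℝ) < ((river a b y z).turn true).edge := by exact_mod_cast hup.edge_pos
  have hterm : (river a b y z).term m =
      ENNReal.ofReal (m / ((river a b y z).turn true).edge) := by
    rw [term, if_neg, s1, s2, hup.starAbs]
    · congr 1
      field_simp
    · have h1 := mul_pos ha hy
      have h2 := mul_pos hb hz
      have h3 := mul_pos (sub_pos.2 hab) (add_pos hy hz)
      simp only [river]
      rintro (h | h | h)
      · omega
      · omega
      · nlinarith
  rw [total_eq, hterm, hup.total_eq hm0, ← turn_false_river,
    ← ENNReal.ofReal_add (by positivity) (hup.upValue_nonneg hm0), upValue, add_sub_cancel]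
  congr 2
  rw [arcothDiv, turn_true_river]
  congr 2
  push_cast
  rw [← hm, show (a * z - b * y + 2 * (a * y) + (a * z + b * y) : ℝ) = 2 * (a * (y + z)) by ring,
    show (a * z - b * y + 2 * (a * y) - (a * z + b * y) : ℝ) = 2 * (y * (a - b)) by ring,
    mul_div_mul_left _ _ two_ne_zero]

/-- The river ends where the region ahead has label `g - g = 0` times `y + z`; both continuations
run along the shore of that lake. -/
theorem total_river_self {m g y z : ℤ} (hm : g * (y + z) = m) :
    (river g g y z).total m =
      (⟨0, g * y, m⟩ : EdgeState).total m + (⟨0, g * z, m⟩ : EdgeState).total m := by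
  have h0 : (river g g y z).term m = 0 := by
    rw [term, if_pos]
    right; right
    simp only [river]
    ring
  have h1 : (river g g y z).turn true = (⟨0, g * y, m⟩ : EdgeState).mirror := by
    rw [turn_true_river]
    ext <;> simp [mirror, ← hm]
    ring
  have h2 : (river g g y z).turn false = (⟨0, g * z, m⟩ : EdgeState).neg := by
    rw [turn_false_river]
    ext <;> simp [neg, river, ← hm]
  rw [total_eq, h0, h1, h2, total_mirror, total_neg, zero_add]

end EdgeState

/-! ### `W₁` as a regularized limit of harmonic-type sums. -/

open MeasureTheory Filter Topology in
theorem integrableOn_inv_one_add_sq_Ioi :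
    IntegrableOn (fun y : ℝ => (1 + y ^ 2)⁻¹) (Set.Ioi 0) := integrable_inv_one_add_sq.integrableOn

/-- A rescaled Poisson kernel. -/
noncomputable def poissonTerm (y v : ℝ) : ℝ := y / (y ^ 2 + 4 * v ^ 2)

theorem poissonTerm_nonneg {y : ℝ} (hy : 0 < y) (v : ℝ) : 0 ≤ poissonTerm y v := by
  unfold poissonTerm; positivity

theorem poissonTerm_anti {y u v : ℝ} (hy : 0 < y) (hu : 0 ≤ u) (huv : u ≤ v) :
    poissonTerm y v ≤ poissonTerm y u := by
  unfold poissonTerm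
  gcongr

theorem continuous_poissonTerm {y : ℝ} (hy : 0 < y) : Continuous (poissonTerm y) := by
  unfold poissonTerm
  exact continuous_const.div (by fun_prop) fun v => by positivity

theorem integral_poissonTerm {y : ℝ} (hy : 0 < y) (N : ℝ) :
    ∫ v in (0 : ℝ)..N, poissonTerm y v = Real.arctan (2 * N / y) / 2 := by
  have hd : ∀ v ∈ Set.uIcc 0 N,
      HasDerivAt (fun v => Real.arctan (2 * v / y) / 2) (poissonTerm y v) v := by
    intro v _
    have h := ((((hasDerivAt_id v).const_mul 2).div_const y).arctan).div_const 2
    refine h.congr_deriv ?_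
    simp only [poissonTerm, id]
    field_simp
    ring
  rw [intervalIntegral.integral_eq_sub_of_hasDerivAt hd
    ((continuous_poissonTerm hy).intervalIntegrable _ _)]
  simp

/-- Integral test for a decreasing function: sum and integral differ by at most the value `1 / y` at
`0`. -/
theorem abs_sum_poissonTerm_sub_le {x y : ℝ} (hy : 0 < y) (hx0 : 0 ≤ x) (hx1 : x ≤ 1) (N : ℕ) :
    |∑ k ∈ Finset.range N, poissonTerm y (x + k) - Real.arctan (2 * N / y) / 2| ≤ 1 / y := by
  have hanti : AntitoneOn (poissonTerm y) (Set.Icc 0 (0 + (N : ℝ))) :=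
    fun u hu v _ huv => poissonTerm_anti hy hu.1 huv
  have h1 := hanti.sum_le_integral
  have h2 := hanti.integral_le_sum
  simp only [zero_add] at h1 h2
  rw [integral_poissonTerm hy] at h1 h2
  have h0 : poissonTerm y 0 = 1 / y := by
    unfold poissonTerm; field_simp; ring
  have h3 : ∑ k ∈ Finset.range N, poissonTerm y k + poissonTerm y N =
      ∑ k ∈ Finset.range N, poissonTerm y ((k + 1 : ℕ) : ℝ) + 1 / y := by
    rw [← Finset.sum_range_succ (fun k : ℕ => poissonTerm y k), Finset.sum_range_succ']
    simp [h0]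
  have h4 : ∑ k ∈ Finset.range N, poissonTerm y (x + k) ≤
      ∑ k ∈ Finset.range N, poissonTerm y k :=
    Finset.sum_le_sum fun k _ => poissonTerm_anti hy k.cast_nonneg (by linarith)
  have h5 : ∑ k ∈ Finset.range N, poissonTerm y ((k + 1 : ℕ) : ℝ) ≤
      ∑ k ∈ Finset.range N, poissonTerm y (x + k) :=
    Finset.sum_le_sum fun k _ => poissonTerm_anti hy (by positivity) (by push_cast; linarith)
  have h6 := poissonTerm_nonneg hy N
  rw [abs_le]
  constructor <;> linarith

theorem im_one_div_sub_mul_I (u y : ℝ) :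
    (1 / ((u : ℂ) - Complex.I * (y / 2))).im = 2 * poissonTerm y u := by
  rw [one_div, Complex.inv_im]
  simp only [Complex.normSq_apply, poissonTerm]
  simp only [Complex.sub_im, Complex.sub_re, Complex.ofReal_im, Complex.ofReal_re,
    Complex.mul_im, Complex.mul_re, Complex.I_re, Complex.I_im, Complex.div_ofNat_re,
    Complex.div_ofNat_im]
  have : (u - (0 * (y / 2) - 1 * (0 / 2))) * (u - (0 * (y / 2) - 1 * (0 / 2))) +
      (0 - (0 * (0 / 2) + 1 * (y / 2))) * (0 - (0 * (0 / 2) + 1 * (y / 2))) =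
      (y ^ 2 + 4 * u ^ 2) / 4 := by ring
  rw [this, div_div_eq_mul_div]
  ring

theorem norm_exp_pi_mul (x y : ℝ) :
    ‖Complex.exp (Real.pi * (y + 2 * Complex.I * x))‖ = Real.exp (Real.pi * y) := by
  rw [Complex.norm_exp]
  congr 1
  simp

theorem pi_mul_le_norm_exp_sub_one (x y : ℝ) :
    Real.pi * y ≤ ‖Complex.exp (Real.pi * (y + 2 * Complex.I * x)) - 1‖ := by
  have h1 := norm_sub_norm_le (Complex.exp (Real.pi * (y + 2 * Complex.I * x))) 1
  rw [norm_exp_pi_mul, norm_one] at h1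
  have h2 := Real.add_one_le_exp (Real.pi * y)
  linarith

open Filter Topology in
theorem tendsto_poissonTerm_atTop {y : ℝ} (x : ℝ) :
    Tendsto (fun n : ℕ => poissonTerm y (x + n)) atTop (𝓝 0) := by
  unfold poissonTerm
  refine Tendsto.div_atTop tendsto_const_nhds ?_
  refine tendsto_atTop_add_const_left _ _ (Tendsto.const_mul_atTop (by norm_num) ?_)
  exact (tendsto_pow_atTop two_ne_zero).comp
    (tendsto_atTop_add_const_left _ _ tendsto_natCast_atTop_atTop)

-- This is half the imaginary part of the partial fraction expansion of `π cot (π z)` at `z = x - i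
-- y / 2`, with the cotangent rewritten by exponentials.
open Filter Topology in
theorem tendsto_sum_poissonTerm {x y : ℝ} (hy : 0 < y) :
    Tendsto (fun N : ℕ => ∑ k ∈ Finset.range N, poissonTerm y (x + k) +
      ∑ k ∈ Finset.range N, poissonTerm y (1 - x + k)) atTop
      (𝓝 (Real.pi * ((1 / (Complex.exp (Real.pi * (y + 2 * Complex.I * x)) - 1)).re + 1 / 2))) := by
  set z : ℂ := x - Complex.I * (y / 2) with hz
  have hzc : z ∈ Complex.integerComplement := by
    rintro ⟨n, hn⟩
    have := congrArg Complex.im hn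
    simp [hz] at this
    exact hy.ne' this
  have h1 := (Complex.continuous_im.tendsto _).comp (tendsto_logDeriv_euler_cot_sub hzc)
  have hE : Complex.exp (2 * Real.pi * Complex.I * z) =
      Complex.exp (Real.pi * (y + 2 * Complex.I * x)) := by
    congr 1
    rw [hz]
    ring_nf
    rw [Complex.I_sq]
    ring
  have hne : Complex.exp (Real.pi * (y + 2 * Complex.I * x)) - 1 ≠ 0 := by
    rw [← norm_pos_iff]
    exact (by positivity : 0 < Real.pi * y).trans_le (pi_mul_le_norm_exp_sub_one x y)
  have hcot : (Real.pi * Complex.cot (Real.pi * z)).im =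
      Real.pi * (2 * (1 / (Complex.exp (Real.pi * (y + 2 * Complex.I * x)) - 1)).re + 1) := by
    rw [Complex.cot_pi_eq_exp_ratio, hE]
    set E := Complex.exp (Real.pi * (y + 2 * Complex.I * x))
    have h2 : (E + 1) / (Complex.I * (1 - E)) = Complex.I * (2 * (1 / (E - 1)) + 1) := by
      have h3 : 1 - E ≠ 0 := by
        intro h
        apply hne
        linear_combination -h
      field_simp [Complex.I_ne_zero]
      rw [Complex.I_sq]
      ring
    rw [h2, Complex.im_ofReal_mul]
    simp
  -- `cotTerm z j` pairs `z - (j + 1)` with `z + (j + 1)`; together with `1 / z` the shifts of `x`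
  -- run up to `N` instead of `N - 1`, hence the subtracted term.
  have hsum : ∀ N : ℕ, ∑ k ∈ Finset.range N, poissonTerm y (x + k) +
      ∑ k ∈ Finset.range N, poissonTerm y (1 - x + k) =
      ((∑ j ∈ Finset.range N, cotTerm z j).im + (1 / z).im) / 2 - poissonTerm y (x + N) := by
    intro N
    rw [Complex.im_sum]
    have h2 : ∀ j : ℕ, (cotTerm z j).im =
        2 * poissonTerm y (1 - x + j) + 2 * poissonTerm y (x + (j + 1 : ℕ)) := by
      intro j
      rw [cotTerm, Complex.add_im]
      have e1 : z - (j + 1) = ((x - (j + 1) : ℝ) : ℂ) - Complex.I * (y / 2) := by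
        rw [hz]; push_cast; ring
      have e2 : z + (j + 1) = ((x + (j + 1 : ℕ) : ℝ) : ℂ) - Complex.I * (y / 2) := by
        rw [hz]; push_cast; ring
      rw [e1, e2, im_one_div_sub_mul_I, im_one_div_sub_mul_I]
      have e3 : poissonTerm y (x - (j + 1)) = poissonTerm y (1 - x + j) := by
        unfold poissonTerm; congr 1; ring
      rw [e3]
    have h3 : (1 / z).im = 2 * poissonTerm y (x + (0 : ℕ)) := by
      rw [hz, im_one_div_sub_mul_I]; simp
    have h4 := Finset.sum_range_succ (fun k : ℕ => poissonTerm y (x + k)) N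
    rw [Finset.sum_range_succ'] at h4
    rw [Finset.sum_congr rfl fun j _ => h2 j, Finset.sum_add_distrib, ← Finset.mul_sum,
      ← Finset.mul_sum, h3, eq_sub_of_add_eq h4.symm]
    ring
  simp only [hsum]
  have h5 := ((h1.add_const (1 / z).im).div_const 2).sub (tendsto_poissonTerm_atTop (y := y) x)
  rw [Complex.sub_im, hcot, sub_add_cancel, sub_zero] at h5
  refine (h5.congr fun _ => rfl).trans (le_of_eq ?_)
  congr 1
  ring

open MeasureTheory Filter Topology in
theorem integrableOn_sq_div {c : ℝ} :
    IntegrableOn (fun y : ℝ => y ^ 2 / ((y ^ 2 + 1) * (y ^ 2 + c ^ 2))) (Set.Ioi 0) := by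
  refine Integrable.mono' integrableOn_inv_one_add_sq_Ioi
    (Measurable.aestronglyMeasurable (by fun_prop)) (ae_restrict_of_forall_mem measurableSet_Ioi fun y hy => ?_)
  have hy : (0 : ℝ) < y := hy
  rw [Real.norm_of_nonneg (by positivity), inv_eq_one_div, div_le_div_iff₀ (by positivity)
    (by positivity)]
  nlinarith [mul_nonneg (sq_nonneg y) (sq_nonneg c), sq_nonneg c]

open MeasureTheory Filter Topology in
theorem integral_sq_div {c : ℝ} (hc : 0 ≤ c) :
    ∫ y in Set.Ioi (0 : ℝ), y ^ 2 / ((y ^ 2 + 1) * (y ^ 2 + c ^ 2)) =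
      Real.pi / 2 / (1 + c) := by
  rcases hc.eq_or_lt with rfl | hc
  · rw [show Real.pi / 2 / (1 + 0) = Real.pi / 2 - Real.arctan 0 by simp,
      ← integral_Ioi_inv_one_add_sq]
    refine setIntegral_congr_fun measurableSet_Ioi fun y hy => ?_
    have hy : (0 : ℝ) < y := hy
    field_simp
    ring
  have harc : Tendsto Real.arctan atTop (𝓝 (Real.pi / 2)) :=
    Real.tendsto_arctan_atTop.mono_right nhdsWithin_le_nhds
  -- For `c = 1` the partial fractions degenerate to a double factor, and another antiderivative is
  -- needed.
  by_cases hc1 : c = 1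
  · subst hc1
    have hd : ∀ y ∈ Set.Ici (0 : ℝ), HasDerivAt (fun y => (Real.arctan y - y / (y ^ 2 + 1)) / 2)
        (y ^ 2 / ((y ^ 2 + 1) * (y ^ 2 + 1 ^ 2))) y := by
      intro y _
      have h := ((Real.hasDerivAt_arctan y).sub ((hasDerivAt_id y).div
        (((hasDerivAt_id y).pow 2).add_const 1)
        (ne_of_gt (by positivity : (0 : ℝ) < y ^ 2 + 1)))).div_const 2
      refine h.congr_deriv ?_
      simp only [id, Pi.pow_apply]
      field_simp
      ring
    have ht : Tendsto (fun y : ℝ => (Real.arctan y - y / (y ^ 2 + 1)) / 2) atTop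
        (𝓝 ((Real.pi / 2 - 0) / 2)) := by
      refine (harc.sub ?_).div_const 2
      refine squeeze_zero' (g := fun y : ℝ => y⁻¹) ?_ ?_ tendsto_inv_atTop_zero
      · filter_upwards [eventually_gt_atTop 0] with y hy
        positivity
      · filter_upwards [eventually_gt_atTop 0] with y hy
        rw [inv_eq_one_div, div_le_div_iff₀ (by positivity) hy]
        nlinarith
    rw [integral_Ioi_of_hasDerivAt_of_nonneg' hd (fun y _ => by positivity) ht]
    simp
    ring
  · have hc2 : c ^ 2 - 1 ≠ 0 := by
      intro h
      have : (c - 1) * (c + 1) = 0 := by linear_combination h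
      rcases mul_eq_zero.1 this with h | h
      · exact hc1 (by linarith)
      · linarith
    have hd : ∀ y ∈ Set.Ici (0 : ℝ), HasDerivAt
        (fun y => (c * Real.arctan (y / c) - Real.arctan y) / (c ^ 2 - 1))
        (y ^ 2 / ((y ^ 2 + 1) * (y ^ 2 + c ^ 2))) y := by
      intro y _
      have h := (((((hasDerivAt_id y).div_const c).arctan).const_mul c).sub
        (Real.hasDerivAt_arctan y)).div_const (c ^ 2 - 1)
      refine h.congr_deriv ?_
      simp only [id]
      field_simp
      ring
    have ht : Tendsto (fun y : ℝ => (c * Real.arctan (y / c) - Real.arctan y) / (c ^ 2 - 1)) atTop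
        (𝓝 ((c * (Real.pi / 2) - Real.pi / 2) / (c ^ 2 - 1))) :=
      (((harc.comp (tendsto_id.atTop_div_const hc)).const_mul c).sub harc).div_const _
    rw [integral_Ioi_of_hasDerivAt_of_nonneg' hd (fun y _ => by positivity) ht]
    simp
    field_simp
    ring

-- The arctangent is twice the integral of `poissonTerm y` over `[0, N]`; interchanging the
-- integrals leaves `∫ 2 / (1 + 2v)`.
open MeasureTheory Filter Topology in
theorem integral_mul_arctan (N : ℕ) :
    ∫ y in Set.Ioi (0 : ℝ), y / (y ^ 2 + 1) * Real.arctan (2 * N / y) =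
      Real.pi / 2 * Real.log (1 + 2 * N) := by
  have hN : (0 : ℝ) ≤ N := N.cast_nonneg
  have h1 : ∫ y in Set.Ioi (0 : ℝ), y / (y ^ 2 + 1) * Real.arctan (2 * N / y) =
      ∫ y in Set.Ioi (0 : ℝ), ∫ v in Set.Ioc (0 : ℝ) N,
        2 * (y ^ 2 / ((y ^ 2 + 1) * (y ^ 2 + (2 * v) ^ 2))) := by
    refine setIntegral_congr_fun measurableSet_Ioi fun y hy => ?_
    have hy : (0 : ℝ) < y := hy
    rw [← intervalIntegral.integral_of_le hN]
    have : Real.arctan (2 * N / y) = 2 * ∫ v in (0 : ℝ)..N, poissonTerm y v := by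
      rw [integral_poissonTerm hy]; ring
    rw [this, ← mul_assoc, ← intervalIntegral.integral_const_mul]
    refine intervalIntegral.integral_congr fun v _ => ?_
    simp only [poissonTerm]
    field_simp
    ring
  rw [h1, integral_integral_swap]
  · have h2 : ∀ v ∈ Set.Ioc (0 : ℝ) N, ∫ y in Set.Ioi (0 : ℝ),
        2 * (y ^ 2 / ((y ^ 2 + 1) * (y ^ 2 + (2 * v) ^ 2))) = Real.pi / 2 * (2 / (1 + 2 * v)) := by
      intro v hv
      rw [integral_const_mul, integral_sq_div (by have := hv.1; positivity)]
      ring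
    rw [setIntegral_congr_fun measurableSet_Ioc h2, integral_const_mul,
      ← intervalIntegral.integral_of_le hN]
    congr 1
    have hd : ∀ v ∈ Set.uIcc (0 : ℝ) N,
        HasDerivAt (fun v => Real.log (1 + 2 * v)) (2 / (1 + 2 * v)) v := by
      intro v hv
      rw [Set.uIcc_of_le hN] at hv
      have hv0 := hv.1
      have h := (((hasDerivAt_id v).const_mul 2).const_add 1).log (by simp only [id]; positivity)
      simpa using h
    rw [intervalIntegral.integral_eq_sub_of_hasDerivAt hd]
    · simp
    · refine ContinuousOn.intervalIntegrable (ContinuousOn.div (by fun_prop) (by fun_prop) ?_)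
      intro v hv
      rw [Set.uIcc_of_le hN] at hv
      have hv0 := hv.1
      positivity
  · have hb : Integrable (fun q : ℝ × ℝ => (2 * (1 + q.1 ^ 2)⁻¹) * (1 : ℝ))
        ((volume.restrict (Set.Ioi (0 : ℝ))).prod (volume.restrict (Set.Ioc (0 : ℝ) N))) :=
      Integrable.mul_prod (f := fun y : ℝ => 2 * (1 + y ^ 2)⁻¹) (g := fun _ : ℝ => (1 : ℝ))
        (integrableOn_inv_one_add_sq_Ioi.const_mul 2) (integrable_const _)
    refine hb.mono' (Measurable.aestronglyMeasurable (by unfold Function.uncurry; fun_prop)) ?_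
    rw [Measure.prod_restrict]
    refine ae_restrict_of_forall_mem (measurableSet_Ioi.prod measurableSet_Ioc) fun q hq => ?_
    have hq1 : 0 < q.1 := hq.1
    simp only [Function.uncurry]
    rw [Real.norm_of_nonneg (by positivity), mul_one]
    gcongr
    rw [inv_eq_one_div, div_le_div_iff₀ (by positivity) (by positivity)]
    nlinarith [mul_nonneg (sq_nonneg q.1) (sq_nonneg q.2), sq_nonneg q.2]

open MeasureTheory Filter Topology in
theorem integrableOn_W₁_integrand (x : ℝ) : IntegrableOn (fun y : ℝ => (((y / (y ^ 2 + 1) : ℝ)) : ℂ) *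
    (1 / (Complex.exp (Real.pi * (y + 2 * Complex.I * x)) - 1))) (Set.Ioi 0) := by
  refine Integrable.mono' (g := fun y : ℝ => Real.pi⁻¹ * (1 + y ^ 2)⁻¹)
    (integrableOn_inv_one_add_sq_Ioi.const_mul _)
    (Measurable.aestronglyMeasurable (by fun_prop))
    (ae_restrict_of_forall_mem measurableSet_Ioi fun y hy => ?_)
  have hy : (0 : ℝ) < y := hy
  have h := pi_mul_le_norm_exp_sub_one x y
  rw [norm_mul, norm_div, norm_one, Complex.norm_real, Real.norm_of_nonneg (by positivity)]
  calc y / (y ^ 2 + 1) * (1 / ‖Complex.exp (Real.pi * (y + 2 * Complex.I * x)) - 1‖)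
      ≤ y / (y ^ 2 + 1) * (1 / (Real.pi * y)) := by gcongr
    _ = Real.pi⁻¹ * (1 + y ^ 2)⁻¹ := by field_simp; ring

theorem W₁_add_int (x : ℝ) (n : ℤ) : W₁ (x + n) = W₁ x := by
  unfold W₁
  have h : ∀ y : ℝ, Complex.exp (Real.pi * (y + 2 * Complex.I * ((x + n : ℝ) : ℂ))) =
      Complex.exp (Real.pi * (y + 2 * Complex.I * x)) := by
    intro y
    rw [← Complex.exp_periodic.int_mul n (Real.pi * (y + 2 * Complex.I * x))]
    congr 1
    push_cast
    ring
  simp only [h]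

theorem integral_mul_poissonTerm {u : ℝ} (hu : 0 ≤ u) :
    ∫ y in Set.Ioi (0 : ℝ), y / (y ^ 2 + 1) * poissonTerm y u = Real.pi / 2 * (1 / (1 + 2 * u)) := by
  have h := integral_sq_div (c := 2 * u) (by positivity)
  rw [mul_one_div, ← h]
  congr 1
  ext y
  unfold poissonTerm
  rw [div_mul_div_comm]
  congr 1 <;> ring

open MeasureTheory Filter Topology in
theorem integrableOn_mul_poissonTerm (u : ℝ) :
    IntegrableOn (fun y : ℝ => y / (y ^ 2 + 1) * poissonTerm y u) (Set.Ioi 0) := by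
  refine (integrableOn_sq_div (c := 2 * u)).congr (Eventually.of_forall fun y => ?_)
  simp only [poissonTerm]
  rw [div_mul_div_comm]
  congr 1 <;> ring

-- Integrating `poissonTerm y u` against `y / (y² + 1)` gives `π / 2` times `1 / (1 + 2u)`.
-- Subtracting `arctan (2N / y)`, which tends to `π / 2`, removes the constant `1 / 2` in
-- `tendsto_sum_poissonTerm` and bounds the integrand by `2 / (1 + y²)`, so dominated convergence
-- applies; its integral produces the logarithm. The endpoint `x = 0` is needed for adjacent lakes.
open MeasureTheory Filter Topology in
theorem tendsto_W₁ {x : ℝ} (hx0 : 0 ≤ x) (hx1 : x ≤ 1) :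
    Tendsto (fun N : ℕ => ∑ k ∈ Finset.range N, 1 / (1 + 2 * (x + k)) +
      ∑ k ∈ Finset.range N, 1 / (1 + 2 * (1 - x + k)) - Real.log (1 + 2 * N)) atTop
      (𝓝 (W₁ x)) := by
  have hx1' : 0 ≤ 1 - x := by linarith
  set S : ℕ → ℝ → ℝ := fun N y => ∑ k ∈ Finset.range N, poissonTerm y (x + k) +
    ∑ k ∈ Finset.range N, poissonTerm y (1 - x + k) with hS
  have hSint : ∀ N, IntegrableOn (fun y : ℝ => y / (y ^ 2 + 1) * S N y) (Set.Ioi 0) := by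
    intro N
    simp only [hS, mul_add, Finset.mul_sum]
    exact (integrable_finsetSum _ fun k _ => integrableOn_mul_poissonTerm _).add
      (integrable_finsetSum _ fun k _ => integrableOn_mul_poissonTerm _)
  have hSval : ∀ N, ∫ y in Set.Ioi (0 : ℝ), y / (y ^ 2 + 1) * S N y =
      Real.pi / 2 * (∑ k ∈ Finset.range N, 1 / (1 + 2 * (x + k)) +
        ∑ k ∈ Finset.range N, 1 / (1 + 2 * (1 - x + k))) := by
    intro N
    simp only [hS, mul_add, Finset.mul_sum]
    rw [integral_add (integrable_finsetSum _ fun k _ => integrableOn_mul_poissonTerm _)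
      (integrable_finsetSum _ fun k _ => integrableOn_mul_poissonTerm _),
      integral_finsetSum _ fun k _ => integrableOn_mul_poissonTerm _,
      integral_finsetSum _ fun k _ => integrableOn_mul_poissonTerm _]
    congr 1 <;> refine Finset.sum_congr rfl fun k _ => ?_ <;>
      rw [integral_mul_poissonTerm (by positivity)] <;> ring
  have hbound : ∀ N, ∀ y : ℝ, 0 < y →
      ‖y / (y ^ 2 + 1) * (S N y - Real.arctan (2 * N / y))‖ ≤ 2 * (1 + y ^ 2)⁻¹ := by
    intro N y hy
    have h1 := abs_sum_poissonTerm_sub_le hy hx0 hx1 N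
    have h2 := abs_sum_poissonTerm_sub_le hy hx1' (by linarith) N
    have h3 : |S N y - Real.arctan (2 * N / y)| ≤ 2 / y := by
      rw [abs_le] at *
      have : 2 / y = 1 / y + 1 / y := by ring
      simp only [hS]
      constructor <;> linarith
    rw [norm_mul, Real.norm_of_nonneg (by positivity), Real.norm_eq_abs]
    calc y / (y ^ 2 + 1) * |S N y - Real.arctan (2 * N / y)| ≤ y / (y ^ 2 + 1) * (2 / y) := by
          gcongr
      _ = 2 * (1 + y ^ 2)⁻¹ := by field_simp; ring
  have hmeas : ∀ N, Measurable fun y : ℝ => y / (y ^ 2 + 1) * (S N y - Real.arctan (2 * N / y)) := by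
    intro N
    simp only [hS, poissonTerm]
    fun_prop
  have hbint : IntegrableOn (fun y : ℝ => 2 * (1 + y ^ 2)⁻¹) (Set.Ioi 0) :=
    integrableOn_inv_one_add_sq_Ioi.const_mul _
  have hFint : ∀ N, IntegrableOn
      (fun y : ℝ => y / (y ^ 2 + 1) * (S N y - Real.arctan (2 * N / y))) (Set.Ioi 0) :=
    fun N => hbint.mono' (hmeas N).aestronglyMeasurable
      (ae_restrict_of_forall_mem measurableSet_Ioi fun y hy => hbound N y hy)
  have hval : ∀ N : ℕ, ∫ y in Set.Ioi (0 : ℝ), y / (y ^ 2 + 1) * (S N y - Real.arctan (2 * N / y)) =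
      Real.pi / 2 * (∑ k ∈ Finset.range N, 1 / (1 + 2 * (x + k)) +
        ∑ k ∈ Finset.range N, 1 / (1 + 2 * (1 - x + k)) - Real.log (1 + 2 * N)) := by
    intro N
    have hA : IntegrableOn (fun y : ℝ => y / (y ^ 2 + 1) * Real.arctan (2 * N / y)) (Set.Ioi 0) := by
      refine ((hSint N).sub (hFint N)).congr (Eventually.of_forall fun y => ?_)
      simp only [Pi.sub_apply]
      ring
    simp only [mul_sub]
    rw [integral_sub (hSint N) hA, hSval, integral_mul_arctan]
  have hlim := tendsto_integral_of_dominated_convergence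
    (μ := volume.restrict (Set.Ioi (0 : ℝ)))
    (F := fun N y => y / (y ^ 2 + 1) * (S N y - Real.arctan (2 * N / y)))
    (f := fun y => Real.pi * (y / (y ^ 2 + 1) *
      (1 / (Complex.exp (Real.pi * (y + 2 * Complex.I * x)) - 1)).re))
    (fun y => 2 * (1 + y ^ 2)⁻¹) (fun N => (hmeas N).aestronglyMeasurable) hbint
    (fun N => ae_restrict_of_forall_mem measurableSet_Ioi fun y hy => hbound N y hy)
    (ae_restrict_of_forall_mem measurableSet_Ioi fun y hy => by
      have hy : (0 : ℝ) < y := hy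
      have h1 := tendsto_sum_poissonTerm (x := x) hy
      have h2 : Tendsto (fun N : ℕ => Real.arctan (2 * N / y)) atTop (𝓝 (Real.pi / 2)) :=
        (Real.tendsto_arctan_atTop.mono_right nhdsWithin_le_nhds).comp
          ((tendsto_natCast_atTop_atTop.const_mul_atTop two_pos).atTop_div_const hy)
      have h3 := (h1.sub h2).const_mul (y / (y ^ 2 + 1))
      refine h3.trans (le_of_eq ?_)
      congr 1
      ring)
  simp only [hval] at hlim
  rw [integral_const_mul] at hlim
  have hre : ∫ y in Set.Ioi (0 : ℝ), y / (y ^ 2 + 1) *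
      (1 / (Complex.exp (Real.pi * (y + 2 * Complex.I * x)) - 1)).re = W₁ x / 2 := by
    have h := Complex.reCLM.integral_comp_comm (integrableOn_W₁_integrand x)
    rw [W₁, mul_div_cancel_left₀ _ two_ne_zero, ← Complex.reCLM_apply, ← h]
    congr 1
    ext y
    rw [Complex.reCLM_apply, Complex.re_ofReal_mul]
  rw [hre] at hlim
  have h := hlim.const_mul (2 / Real.pi)
  have hpi := Real.pi_ne_zero
  refine (h.congr fun N => ?_).trans (le_of_eq ?_)
  · field_simp
  · congr 1
    field_simp

/-! ### Lake sums in closed form. -/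

/-- The sum of the contributions of the `k`-th tree at a lake, for `y = x + k`. -/
noncomputable def lakeTerm (y : ℝ) : ℝ := Real.log ((y + 1) / y) / 2 - 1 / (2 * y + 1)

/-- The sum of the contributions of the trees at a lake between regions of the same sign. -/
noncomputable def lakeSum (x : ℝ) : ℝ := ∑' k : ℕ, lakeTerm (x + k)

theorem lakeTerm_eq {y : ℝ} (hy : 0 < y) :
    lakeTerm y = arcothDiv 1 (2 * y + 1) - 1 / (2 * y + 1) := by
  rw [lakeTerm, arcothDiv]
  congr 3
  field_simp
  ring

theorem lakeTerm_nonneg {y : ℝ} (hy : 0 < y) : 0 ≤ lakeTerm y := by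
  rw [lakeTerm_eq hy, sub_nonneg]
  exact div_le_arcothDiv one_pos (by linarith)

/-- A telescoping majorant, used for summability. -/
theorem lakeTerm_le {y : ℝ} (hy : 0 < y) : lakeTerm y ≤ 1 / (2 * y) - 1 / (2 * (y + 1)) := by
  have h1 : Real.log ((y + 1) / y) ≤ (y + 1) / y - 1 :=
    Real.log_le_sub_one_of_pos (by positivity)
  have h2 : (y + 1) / y - 1 = 2 * (1 / (2 * y)) := by field_simp; ring
  have h3 : 1 / (2 * (y + 1)) ≤ 1 / (2 * y + 1) := by
    gcongr
    linarith
  rw [lakeTerm]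
  linarith

theorem summable_lakeTerm {x : ℝ} (hx : 0 < x) : Summable fun k : ℕ => lakeTerm (x + k) := by
  refine summable_of_sum_range_le (c := 1 / (2 * x)) (fun k => lakeTerm_nonneg (by positivity))
    fun n => ?_
  have h : ∑ k ∈ Finset.range n, lakeTerm (x + k) ≤ 1 / (2 * x) - 1 / (2 * (x + n)) := by
    induction n with
    | zero => simp
    | succ n ih =>
      rw [Finset.sum_range_succ]
      have := lakeTerm_le (y := x + n) (by positivity)
      push_cast
      rw [← add_assoc]
      linarith
  have : 0 ≤ 1 / (2 * (x + n)) := by positivity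
  linarith

theorem lakeSum_nonneg {x : ℝ} (hx : 0 < x) : 0 ≤ lakeSum x :=
  tsum_nonneg fun k => lakeTerm_nonneg (by positivity)

open Filter Topology in
theorem tendsto_lakeSum {x : ℝ} (hx : 0 < x) :
    Tendsto (fun N : ℕ => Real.log ((x + N) / x) / 2 - ∑ k ∈ Finset.range N, 1 / (1 + 2 * (x + k)))
      atTop (𝓝 (lakeSum x)) := by
  refine (summable_lakeTerm hx).hasSum.tendsto_sum_nat.congr fun N => ?_
  induction N with
  | zero => simp [hx.ne']
  | succ N ih =>
    rw [Finset.sum_range_succ, ih, Finset.sum_range_succ, lakeTerm]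
    have h : Real.log ((x + (N + 1 : ℕ)) / x) =
        Real.log ((x + N) / x) + Real.log ((x + N + 1) / (x + N)) := by
      rw [← Real.log_mul (by positivity) (by positivity)]
      congr 1
      push_cast
      field_simp
      ring
    rw [h]
    ring

open Filter Topology in
theorem tendsto_log_add_div (x : ℝ) :
    Tendsto (fun N : ℕ => Real.log ((x + N) / (1 + 2 * N))) atTop (𝓝 (-Real.log 2)) := by
  rw [← Real.log_inv]
  refine Tendsto.log ?_ (by norm_num)
  have h1 : Tendsto (fun N : ℕ => (x - 1 / 2) * (1 / (1 + 2 * (N : ℝ))) + 2⁻¹) atTop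
      (𝓝 ((x - 1 / 2) * 0 + 2⁻¹)) := by
    refine (Tendsto.const_mul _ ?_).add_const _
    refine tendsto_const_nhds.div_atTop (tendsto_atTop_add_const_left _ _ ?_)
    exact tendsto_natCast_atTop_atTop.const_mul_atTop two_pos
  rw [mul_zero, zero_add] at h1
  refine h1.congr fun N => ?_
  have : (0 : ℝ) < 1 + 2 * N := by positivity
  field_simp
  ring

-- The sums of `1 / (1 + 2u)` cancel against those defining the limit `W₁ x`; of the logarithms,
-- `log ((x + N) / (1 + 2N))` tends to `-log 2`.
open Filter Topology in
theorem lakeSum_add_lakeSum {x : ℝ} (hx0 : 0 < x) (hx1 : x < 1) :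
    lakeSum x + lakeSum (1 - x) = -W₁ x - Real.log 2 - Real.log (x * (1 - x)) / 2 := by
  have hx2 : 0 < 1 - x := by linarith
  have h1 := ((tendsto_lakeSum hx0).add (tendsto_lakeSum hx2)).add (tendsto_W₁ hx0.le hx1.le)
  have h2 := (((tendsto_log_add_div x).add (tendsto_log_add_div (1 - x))).div_const 2).sub_const
    (Real.log (x * (1 - x)) / 2)
  have h3 := tendsto_nhds_unique h1 (h2.congr fun N => ?_)
  · linarith
  · have : (0 : ℝ) < 1 + 2 * N := by positivity
    rw [Real.log_div (by positivity) (by positivity), Real.log_div (by positivity) (by positivity),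
      Real.log_div (by positivity) (by positivity), Real.log_div (by positivity) (by positivity),
      Real.log_mul (by positivity) (by positivity)]
    ring

-- At `x = 0` the two sums in `tendsto_W₁` start at `0` and at `1`, while the lake sum uses the
-- second one twice. The difference of the two telescopes to `1 - 1 / (1 + 2N)`, the origin of the
-- constant `1`.
open Filter Topology in
theorem two_mul_lakeSum_one : 2 * lakeSum 1 = 1 - Real.log 2 - W₁ 0 := by
  have h1 := ((tendsto_lakeSum one_pos).const_mul 2).add (tendsto_W₁ le_rfl zero_le_one)
  have h4 : Tendsto (fun N : ℕ => 1 - 1 / (1 + 2 * (N : ℝ))) atTop (𝓝 (1 - 0)) := by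
    refine (tendsto_const_nhds.div_atTop (tendsto_atTop_add_const_left _ _ ?_)).const_sub 1
    exact tendsto_natCast_atTop_atTop.const_mul_atTop two_pos
  have h2 := (tendsto_log_add_div 1).add h4
  have h3 := tendsto_nhds_unique h1 (h2.congr fun N => ?_)
  · linarith
  · have h5 : (0 : ℝ) < 1 + 2 * N := by positivity
    have h6 : ∑ k ∈ Finset.range N, 1 / (1 + 2 * (0 + (k : ℝ))) -
        ∑ k ∈ Finset.range N, 1 / (1 + 2 * (1 + (k : ℝ))) = 1 - 1 / (1 + 2 * (N : ℝ)) := by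
      rw [← Finset.sum_sub_distrib]
      have := Finset.sum_range_sub' (fun k : ℕ => 1 / (1 + 2 * (k : ℝ))) N
      simp only [Nat.cast_zero, mul_zero, add_zero, div_one] at this
      rw [← this]
      refine Finset.sum_congr rfl fun k _ => ?_
      push_cast
      ring
    rw [Real.log_div (by positivity) (by positivity), div_one, sub_zero, ← h6]
    ring

namespace EdgeState

theorem total_lake_eq {m c : ℤ} (hm : 0 < m) (hc : 0 < c) :
    (⟨0, c, m⟩ : EdgeState).total m = ENNReal.ofReal (lakeSum (c / m)) := by
  have hm' : (0 : ℝ) < m := by exact_mod_cast hm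
  have hc' : (0 : ℝ) < c := by exact_mod_cast hc
  rw [total_lake hm hc, lakeSum, ENNReal.ofReal_tsum_of_nonneg
    (fun k => lakeTerm_nonneg (by positivity)) (summable_lakeTerm (by positivity))]
  refine tsum_congr fun k => ?_
  congr 1
  have hy : (0 : ℝ) < c / m + k := by positivity
  rw [lakeTerm_eq hy, upValue, arcothDiv, arcothDiv]
  push_cast
  have e1 : (m + 2 * (c + k * m) : ℝ) = m * (2 * (c / m + k) + 1) := by field_simp; ring
  rw [e1]
  congr 1
  · congr 2
    rw [show (m * (2 * (c / m + k) + 1) + m : ℝ) = m * (2 * (c / m + k) + 1 + 1) by ring,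
      show (m * (2 * (c / m + k) + 1) - m : ℝ) = m * (2 * (c / m + k) + 1 - 1) by ring,
      mul_div_mul_left _ _ hm'.ne']
  · rw [← div_div, div_self hm'.ne']

theorem total_lake_add_total_lake {m c d : ℤ} (hc : 0 < c) (hd : 0 < d) (h : c + d = m) :
    (⟨0, c, m⟩ : EdgeState).total m + (⟨0, d, m⟩ : EdgeState).total m =
      ENNReal.ofReal (-W₁ (c / m) - Real.log 2 - Real.log (c * d / m ^ 2) / 2) ∧
      0 ≤ -W₁ (c / m) - Real.log 2 - Real.log (c * d / m ^ 2) / 2 := by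
  have hc' : (0 : ℝ) < c := by exact_mod_cast hc
  have hd' : (0 : ℝ) < d := by exact_mod_cast hd
  have hm : 0 < m := by omega
  have hm' : (0 : ℝ) < m := by exact_mod_cast hm
  have h' : (c + d : ℝ) = m := by exact_mod_cast h
  have hx : (d / m : ℝ) = 1 - c / m := by rw [← h']; field_simp; ring
  have hx0 : (0 : ℝ) < c / m := by positivity
  have hx1 : (0 : ℝ) < d / m := by positivity
  have key := lakeSum_add_lakeSum hx0 (by rw [hx] at hx1; linarith)
  rw [← hx, show (c / m * (d / m) : ℝ) = c * d / m ^ 2 by field_simp] at key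
  rw [total_lake_eq hm hc, total_lake_eq hm hd, ← ENNReal.ofReal_add (lakeSum_nonneg hx0)
    (lakeSum_nonneg hx1), ← key]
  exact ⟨rfl, add_nonneg (lakeSum_nonneg hx0) (lakeSum_nonneg hx1)⟩

end EdgeState

/-! ### From the topograph to edge states. -/

namespace Topograph

variable {V : Type*} (T : Topograph V)

/-- The labels around a dart. -/
def state (d : T.graph.Dart) : EdgeState :=
  ⟨T.label (T.left d), T.label (T.right d), T.edgeLabel d⟩

theorem label_ahead (d : T.graph.Dart) :
    T.label (T.ahead d) = (T.state d).left + (T.state d).right + (T.state d).edge := by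
  simp only [state, edgeLabel]
  ring

theorem edgeLabel_eq_sub_behind (d : T.graph.Dart) :
    T.edgeLabel d = T.label (T.left d) + T.label (T.right d) - T.label (T.behind d) := by
  have := T.progression d
  rw [edgeLabel]
  linarith

theorem state_turn (b : Bool) (d : T.graph.Dart) : T.state (T.turn b d) = (T.state d).turn b := by
  cases b
  · have h : T.turn false d = T.turnRight d := rfl
    ext
    · rw [h, EdgeState.turn]
      simp only [state, T.left_turnRight, edgeLabel]
      simp
    · rw [h, EdgeState.turn]
      simp only [state, T.right_turnRight]
      simp
    · rw [h, EdgeState.turn]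
      have he := T.edgeLabel_eq_sub_behind (T.turnRight d)
      rw [T.left_turnRight, T.right_turnRight, T.behind_turnRight] at he
      simp only [state, he]
      simp [edgeLabel]
      ring
  · have h : T.turn true d = T.turnLeft d := rfl
    ext
    · rw [h, EdgeState.turn]
      simp only [state, T.left_turnLeft]
      simp
    · rw [h, EdgeState.turn]
      simp only [state, T.right_turnLeft, edgeLabel]
      simp
    · rw [h, EdgeState.turn]
      have he := T.edgeLabel_eq_sub_behind (T.turnLeft d)
      rw [T.left_turnLeft, T.right_turnLeft, T.behind_turnLeft] at he
      simp only [state, he]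
      simp [edgeLabel]
      ring

theorem state_turnLeft (d : T.graph.Dart) : T.state (T.turnLeft d) = (T.state d).turn true :=
  T.state_turn true d

theorem state_turnRight (d : T.graph.Dart) : T.state (T.turnRight d) = (T.state d).turn false :=
  T.state_turn false d

theorem state_symm (d : T.graph.Dart) :
    T.state d.symm = ⟨(T.state d).right, (T.state d).left, -(T.state d).edge⟩ := by
  ext
  · rfl
  · simp only [state, T.right_symm]
  · simp only [state]
    rw [T.edgeLabel_eq_sub_behind, edgeLabel, T.left_symm, T.right_symm,
      PlaneCubicTree.behind, SimpleGraph.Dart.symm_symm]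
    ring

theorem state_follow (d : T.graph.Dart) (w : List Bool) :
    T.state (T.follow d w) = (T.state d).follow w := by
  induction w generalizing d with
  | nil => rfl
  | cons b w ih => rw [PlaneCubicTree.follow, ih, state_turn]; rfl

theorem HasDiscriminant.eq {T : Topograph V} {D : ℤ} (h : T.HasDiscriminant D)
    (d : T.graph.Dart) :
    (T.state d).edge ^ 2 - 4 * (T.state d).left * (T.state d).right = D := by
  have h1 := h d
  have r1 : T.right (T.rot d) = T.left d := T.left_symm_rot d
  have r2 : T.right (T.rot (T.rot d)) = T.left (T.rot d) := T.left_symm_rot _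
  have l2 : T.left (T.rot (T.rot d)) = T.right d := by
    have := T.left_symm_rot (T.rot (T.rot d))
    rw [T.rot_rot_rot] at this
    exact this.symm
  simp only [T.edgeLabel_eq_sub_behind, T.behind_eq, r1, r2, l2, T.rot_rot_rot] at h1
  simp only [state, T.edgeLabel_eq_sub_behind, T.behind_eq]
  rw [h1]
  ring

theorem abs_starLabel {δ : ℝ} (hδ : 0 < δ) (d : T.graph.Dart) :
    |T.starLabel δ d| = (T.state d).starAbs δ := by
  unfold starLabel EdgeState.starAbs
  by_cases h : (T.state d).left * (T.state d).right < 0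
  · rw [if_pos h]
    simp only [state] at h
    rcases mul_neg_iff.1 h with h1 | h1
    · rw [if_pos h1, abs_of_pos hδ]
    · rw [if_neg (by omega), if_pos h1, abs_neg, abs_of_pos hδ]
  · rw [if_neg h, if_neg fun h1 => h (mul_neg_of_pos_of_neg h1.1 h1.2),
      if_neg fun h1 => h (mul_neg_of_neg_of_pos h1.1 h1.2)]
    rfl

theorem vertexTerm_snd {δ : ℝ} (hδ : 0 < δ) (d : T.graph.Dart) :
    T.vertexTerm δ d.snd = 1 / ((T.state d).starAbs δ * ((T.state d).turn true).starAbs δ *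
      ((T.state d).turn false).starAbs δ) := by
  classical
  have hset : {x : T.graph.Dart | x.fst = d.snd} =
      (({d.symm, T.turnRight d, T.turnLeft d} : Finset T.graph.Dart) : Set T.graph.Dart) := by
    ext x
    simp only [Set.mem_ofPred_eq, Finset.coe_insert, Finset.coe_singleton, Set.mem_insert_iff,
      Set.mem_singleton_iff]
    constructor
    · intro h
      rw [T.turnLeft_apply]
      exact T.eq_or_of_fst_eq d.symm x h
    · rintro (rfl | rfl | rfl)
      · rfl
      · exact T.fst_turnRight d
      · exact T.fst_turnLeft d
  have h1 : ∏ᶠ x : {x : T.graph.Dart // x.fst = d.snd}, T.starLabel δ x.1 =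
      T.starLabel δ d.symm * (T.starLabel δ (T.turnRight d) * T.starLabel δ (T.turnLeft d)) := by
    have h2 := finprod_set_coe_eq_finprod_mem (f := T.starLabel δ)
      {x : T.graph.Dart | x.fst = d.snd}
    refine h2.trans ?_
    rw [hset, finprod_mem_coe_finset, Finset.prod_insert, Finset.prod_insert,
      Finset.prod_singleton]
    · rw [Finset.mem_singleton]
      exact fun h => absurd (T.turn_injective d (a₁ := false) (a₂ := true) h) (by simp)
    · simp only [Finset.mem_insert, Finset.mem_singleton, not_or]
      exact ⟨fun h => T.turn_ne_symm false d h.symm, fun h => T.turn_ne_symm true d h.symm⟩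
  rw [vertexTerm, h1, abs_mul, abs_mul, T.abs_starLabel hδ, T.abs_starLabel hδ,
    T.abs_starLabel hδ, T.state_turnLeft, T.state_turnRight]
  have h3 : (T.state d.symm).starAbs δ = (T.state d).starAbs δ := by
    rw [state_symm]
    simp [EdgeState.starAbs, mul_comm]
  rw [h3]
  congr 1
  ring

theorem isLakeVertex_snd (d : T.graph.Dart) : T.IsLakeVertex d.snd ↔ (T.state d).left = 0 ∨
    (T.state d).right = 0 ∨ (T.state d).left + (T.state d).right + (T.state d).edge = 0 := by
  rw [← label_ahead]
  constructor
  · rintro ⟨x, hx, h⟩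
    rcases T.eq_or_of_fst_eq d.symm x hx with rfl | rfl | rfl
    · exact Or.inr (Or.inl h)
    · exact Or.inr (Or.inr h)
    · rw [← T.turnLeft_apply, IsLakeRegion, T.left_turnLeft] at h
      exact Or.inl h
  · rintro (h | h | h)
    · exact ⟨T.turnLeft d, T.fst_turnLeft d, by rw [T.left_turnLeft]; exact h⟩
    · exact ⟨d.symm, rfl, h⟩
    · exact ⟨T.turnRight d, T.fst_turnRight d, h⟩

/-- Any edge `d` splits the vertices into those ahead of `d` and those ahead of `d.symm`. Sums in
`ENNReal` allow this before convergence is known. -/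
theorem tsum_vertexTerm {m : ℝ} (hm : 0 < m) (d : T.graph.Dart) :
    ∑' v : {v : V // ¬ T.IsLakeVertex v}, ENNReal.ofReal (m ^ 3 * T.vertexTerm m v.1) =
      (T.state d).total m + (T.state d.symm).total m := by
  have h1 := tsum_subtype {v : V | ¬ T.IsLakeVertex v}
    fun v => ENNReal.ofReal (m ^ 3 * T.vertexTerm m v)
  refine h1.trans ?_
  have h2 : ∀ x : T.graph.Dart, Set.indicator {v : V | ¬ T.IsLakeVertex v}
      (fun v => ENNReal.ofReal (m ^ 3 * T.vertexTerm m v)) x.snd = (T.state x).term m := by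
    intro x
    by_cases h : T.IsLakeVertex x.snd
    · rw [Set.indicator_of_notMem (by simpa using h), EdgeState.term,
        if_pos ((T.isLakeVertex_snd x).1 h)]
    · rw [Set.indicator_of_mem (show x.snd ∈ {v : V | ¬ T.IsLakeVertex v} from h),
        EdgeState.term, if_neg (mt (T.isLakeVertex_snd x).2 h), T.vertexTerm_snd hm]
  rw [← (T.vertexEquiv d).tsum_eq, Summable.tsum_sum ENNReal.summable ENNReal.summable]
  congr 1
  · exact tsum_congr fun w => (h2 _).trans (by rw [← state_follow]; rfl)
  · exact tsum_congr fun w => (h2 _).trans (by rw [← state_follow]; rfl)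

theorem summable_and_tsum_of_total_eq {m X : ℝ} (hm : 0 < m) (hX : 0 ≤ X) (d : T.graph.Dart)
    (h : (T.state d).total m + (T.state d.symm).total m = ENNReal.ofReal X) :
    Summable (fun v : {v : V // ¬ T.IsLakeVertex v} => T.vertexTerm m v.1) ∧
      m ^ 3 * ∑' v : {v : V // ¬ T.IsLakeVertex v}, T.vertexTerm m v.1 = X := by
  rw [← T.tsum_vertexTerm hm d] at h
  have h0 : ∀ v : {v : V // ¬ T.IsLakeVertex v}, 0 ≤ m ^ 3 * T.vertexTerm m v.1 := fun v =>
    mul_nonneg (by positivity) (div_nonneg zero_le_one (abs_nonneg _))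
  have hs : Summable fun v : {v : V // ¬ T.IsLakeVertex v} => m ^ 3 * T.vertexTerm m v.1 := by
    have := ENNReal.summable_toReal (h.trans_ne ENNReal.ofReal_ne_top)
    refine this.congr fun v => ENNReal.toReal_ofReal (h0 v)
  refine ⟨(summable_mul_left_iff (by positivity)).1 hs, ?_⟩
  rw [← tsum_mul_left]
  rw [← ENNReal.ofReal_tsum_of_nonneg h0 hs] at h
  exact (ENNReal.ofReal_eq_ofReal_iff (tsum_nonneg h0) hX).1 h

/-! ### Location of the lakes. -/

/-- All lakes that touch an edge reached from `d` by turns are in `S`. -/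
def LakesAheadIn (S : Set T.Region) (d : T.graph.Dart) : Prop :=
  ∀ w, (T.IsLakeRegion (T.left (T.follow d w)) → T.left (T.follow d w) ∈ S) ∧
    (T.IsLakeRegion (T.right (T.follow d w)) → T.right (T.follow d w) ∈ S)

variable {T}

theorem LakesAheadIn.of_turn {S : Set T.Region} {d : T.graph.Dart}
    (hl : T.IsLakeRegion (T.left d) → T.left d ∈ S)
    (hr : T.IsLakeRegion (T.right d) → T.right d ∈ S)
    (h1 : T.LakesAheadIn S (T.turnLeft d)) (h2 : T.LakesAheadIn S (T.turnRight d)) :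
    T.LakesAheadIn S d := by
  rintro (_ | ⟨_ | _, w⟩)
  · exact ⟨hl, hr⟩
  · exact h2 w
  · exact h1 w

/-- If `s`, `t`, `e` have one common sign, this persists under every turn, so no label ahead
vanishes. The product form of the hypotheses treats both signs at once. -/
theorem lakesAheadIn_of_same_sign (S : Set T.Region) {d : T.graph.Dart}
    (h1 : 0 < (T.state d).left * (T.state d).right)
    (h2 : 0 < (T.state d).left * (T.state d).edge) : T.LakesAheadIn S d := by
  intro w
  induction w generalizing d with
  | nil =>
    refine ⟨fun h => ?_, fun h => ?_⟩
    · simp [state, show T.label (T.left d) = 0 from h] at h1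
    · simp [state, show T.label (T.right d) = 0 from h] at h1
  | cons b w ih =>
    rw [PlaneCubicTree.follow]
    apply ih <;> rw [state_turn]
    all_goals
      generalize T.state d = x at h1 h2
      obtain ⟨s, t, e⟩ := x
      simp only at h1 h2
      have h3 : s ≠ 0 := by rintro rfl; simp at h1
      have h4 : 0 < s ^ 2 := by positivity
      have h5 : 0 < s ^ 2 * (t * e) := by
        have := mul_pos h1 h2
        nlinarith
      have h6 : 0 < t * e := pos_of_mul_pos_right h5 h4.le
      have h7 : 0 ≤ t ^ 2 := by positivity
      cases b <;> simp [EdgeState.turn] <;> nlinarith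

/-- Left turns stay on the shore of the known lake; a right turn leads to labels of one sign. -/
theorem lakesAheadIn_of_left_mem {S : Set T.Region} {d : T.graph.Dart} (hS : T.left d ∈ S)
    (h1 : (T.state d).left = 0) (h2 : 0 < (T.state d).right * (T.state d).edge) :
    T.LakesAheadIn S d := by
  intro w
  induction w generalizing d with
  | nil =>
    refine ⟨fun _ => hS, fun h => ?_⟩
    simp [state, show T.label (T.right d) = 0 from h] at h2
  | cons b w ih =>
    have h3 : 0 ≤ (T.state d).edge ^ 2 := by positivity
    have h4 : 0 ≤ (T.state d).right ^ 2 := by positivity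
    cases b
    · refine lakesAheadIn_of_same_sign S (d := T.turnRight d) ?_ ?_ w <;>
        rw [state_turnRight] <;> simp [EdgeState.turn, h1] <;> nlinarith
    · refine ih (d := T.turnLeft d) ?_ ?_ ?_
      · rwa [T.left_turnLeft]
      · rw [state_turnLeft]; simp [EdgeState.turn, h1]
      · rw [state_turnLeft]; simp [EdgeState.turn, h1]; nlinarith

theorem lakesAheadIn_of_right_mem {S : Set T.Region} {d : T.graph.Dart} (hS : T.right d ∈ S)
    (h1 : (T.state d).right = 0) (h2 : 0 < (T.state d).left * (T.state d).edge) :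
    T.LakesAheadIn S d := by
  intro w
  induction w generalizing d with
  | nil =>
    refine ⟨fun h => ?_, fun _ => hS⟩
    simp [state, show T.label (T.left d) = 0 from h] at h2
  | cons b w ih =>
    have h3 : 0 ≤ (T.state d).edge ^ 2 := by positivity
    have h4 : 0 ≤ (T.state d).left ^ 2 := by positivity
    cases b
    · refine ih (d := T.turnRight d) ?_ ?_ ?_
      · rwa [T.right_turnRight]
      · rw [state_turnRight]; simp [EdgeState.turn, h1]
      · rw [state_turnRight]; simp [EdgeState.turn, h1]; nlinarith
    · refine lakesAheadIn_of_same_sign S (d := T.turnLeft d) ?_ ?_ w <;>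
        rw [state_turnLeft] <;> simp [EdgeState.turn, h1] <;> nlinarith

theorem mem_of_lakesAheadIn {S : Set T.Region} {d : T.graph.Dart} (h1 : T.LakesAheadIn S d)
    (h2 : T.LakesAheadIn S d.symm) {C : T.Region} (hC : T.IsLakeRegion C) : C ∈ S := by
  obtain ⟨x, rfl⟩ : ∃ x, T.left x = C := Quotient.exists_rep C
  rcases T.exists_reach_eq_or_symm d x with ⟨w | w, hw⟩ | ⟨w | w, hw⟩
  · rw [← hw] at hC ⊢; exact (h1 w).1 hC
  · rw [← hw] at hC ⊢; exact (h2 w).1 hC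
  · rw [← T.right_symm, ← hw] at hC ⊢; exact (h1 w).2 hC
  · rw [← T.right_symm, ← hw] at hC ⊢; exact (h2 w).2 hC

/-- Going around a lake in either direction, the labels of the adjacent regions form an arithmetic
progression. -/
theorem exists_state_eq_add_mul {d : T.graph.Dart} {t m : ℤ} (h : T.state d = ⟨0, t, m⟩) (n : ℤ) :
    ∃ d', T.left d' = T.left d ∧ T.state d' = ⟨0, t + n * m, m⟩ := by
  induction n using Int.induction_on with
  | zero => exact ⟨d, rfl, by simp [h]⟩
  | succ n ih =>
    obtain ⟨d', h1, h2⟩ := ih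
    refine ⟨T.turnLeft d', by rw [T.left_turnLeft, h1], ?_⟩
    rw [state_turnLeft, h2]
    ext <;> simp [EdgeState.turn]
    ring
  | pred n ih =>
    obtain ⟨d', h1, h2⟩ := ih
    obtain ⟨x, rfl⟩ := T.turnLeft.surjective d'
    refine ⟨x, by rw [← h1, T.left_turnLeft], ?_⟩
    rw [state_turnLeft] at h2
    generalize T.state x = y at h2
    obtain ⟨s, u, e⟩ := y
    simp only [EdgeState.turn, if_true, EdgeState.mk.injEq] at h2
    obtain ⟨rfl, h3, h4⟩ := h2
    ext <;> simp
    · linarith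
    · linarith

theorem edge_eq_and_right_modEq {d d' : T.graph.Dart} {t m : ℤ} (h : T.state d = ⟨0, t, m⟩)
    (hd : T.left d' = T.left d) :
    (T.state d').edge = m ∧ (T.state d').right ≡ t [ZMOD m] := by
  have key : ∀ (n : ℕ) (x : T.graph.Dart), (T.state x).left = 0 →
      (T.state ((T.turnLeft ^ n) x)).left = 0 ∧
      (T.state ((T.turnLeft ^ n) x)).edge = (T.state x).edge ∧
      (T.state ((T.turnLeft ^ n) x)).right = (T.state x).right + n * (T.state x).edge := by
    intro n x hx
    induction n with
    | zero => simp [hx]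
    | succ n ih =>
      rw [pow_succ', Equiv.Perm.mul_apply, state_turnLeft]
      obtain ⟨h1, h2, h3⟩ := ih
      simp [EdgeState.turn, h1, h2, h3]
      ring
  obtain ⟨k, hk⟩ : T.turnLeft.SameCycle d d' := Quotient.exact hd.symm
  have hl : (T.state d').left = 0 := by
    have : (T.state d).left = 0 := by rw [h]
    simpa [state, hd] using this
  obtain ⟨n, rfl | rfl⟩ := k.eq_nat_or_neg
  · rw [zpow_natCast] at hk
    subst hk
    obtain ⟨-, h2, h3⟩ := key n d (by rw [h])
    rw [h2, h3, h]
    refine ⟨rfl, ?_⟩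
    simp [Int.ModEq]
  · have hk' : (T.turnLeft ^ n) d' = d := by
      rw [← hk, zpow_neg, zpow_natCast, ← Equiv.Perm.mul_apply, mul_inv_cancel,
        Equiv.Perm.one_apply]
    obtain ⟨-, h2, h3⟩ := key n d' hl
    rw [hk', h] at h2 h3
    simp only at h2 h3
    refine ⟨h2.symm, ?_⟩
    rw [h3, ← h2]
    simp [Int.ModEq]

theorem adjacentResidue_left {m : ℕ} {d : T.graph.Dart} {t e : ℤ} (h : T.state d = ⟨0, t, e⟩)
    (he : (m : ℤ) ∣ e) : T.AdjacentResidue m (T.left d) t := by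
  rintro B ⟨x, hx, rfl⟩
  exact (edge_eq_and_right_modEq h hx).2.of_dvd he

theorem exists_adjacent_left (d : T.graph.Dart) : T.Adjacent (T.left d) (T.right d) :=
  ⟨d, rfl, rfl⟩

theorem AdjacentResidue.modEq {m : ℕ} {d : T.graph.Dart} {r s : ℤ}
    (hr : T.AdjacentResidue m (T.left d) r) (hs : T.AdjacentResidue m (T.left d) s) :
    r ≡ s [ZMOD m] :=
  (hr _ (exists_adjacent_left d)).symm.trans (hs _ (exists_adjacent_left d))

/-- The edge label is constant along a shore, so its sign tells the two lakes apart. -/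
theorem left_ne_left {d d' : T.graph.Dart} {t t' m : ℤ} (hm : 0 < m)
    (h : T.state d = ⟨0, t, m⟩) (h' : T.state d' = ⟨0, t', -m⟩) : T.left d ≠ T.left d' := by
  intro hd
  have h1 := (edge_eq_and_right_modEq h hd.symm).1
  rw [h'] at h1
  simp only at h1
  omega

end Topograph

/-! ### Finding a lake, following the river, and adding up. -/

namespace Topograph

variable {V : Type*} {T : Topograph V}

/-- If the linear form `2 s x + (e + m) y`, a factor of the quadratic form `s x² + e x y + t y²`,
vanishes at a nonzero vector with nonnegative coordinates, then there is a lake whose adjacent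
labels increase by `m` in counterclockwise order. -/
theorem exists_lake_of_nonneg {m : ℤ} (n : ℕ) (d : T.graph.Dart) (x y : ℤ) (hx : 0 ≤ x)
    (hy : 0 ≤ y) (hpos : 0 < x + y) (hn : x + y ≤ n)
    (h1 : 2 * (T.state d).left * x + ((T.state d).edge + m) * y = 0)
    (h2 : ((T.state d).edge - m) * x + 2 * (T.state d).right * y = 0) :
    ∃ d' t, T.state d' = ⟨0, t, m⟩ := by
  induction n generalizing d x y with
  | zero => push_cast at hn; omega
  | succ n ih =>
    push_cast at hn
    -- The Euclidean algorithm on `(x, y)` ends when one coordinate is `0`; the equations then force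
    -- a region beside `d` to be a lake and fix the edge label.
    rcases hy.eq_or_lt with rfl | hy
    · refine ⟨d, (T.state d).right, ?_⟩
      have hx' : x ≠ 0 := by omega
      ext
      · simpa [hx'] using h1
      · rfl
      · have : (T.state d).edge - m = 0 := by simpa [hx'] using h2
        simp only
        omega
    rcases hx.eq_or_lt with rfl | hx
    · refine ⟨d.symm, (T.state d).left, ?_⟩
      have hy' : y ≠ 0 := by omega
      rw [state_symm]
      ext
      · simpa [hy'] using h2
      · rfl
      · have : (T.state d).edge + m = 0 := by simpa [hy'] using h1
        simp only
        omega
    rcases le_total y x with hxy | hxy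
    · refine ih (T.turnLeft d) (x - y) y (by omega) hy.le (by omega) (by omega) ?_ ?_ <;>
        rw [state_turnLeft] <;> simp only [EdgeState.turn, if_true]
      · linear_combination h1
      · linear_combination h1 + h2
    · refine ih (T.turnRight d) x (y - x) hx.le (by omega) (by omega) (by omega) ?_ ?_ <;>
        rw [state_turnRight] <;> simp [EdgeState.turn]
      · linear_combination h1 + h2
      · linear_combination h2

/-- The two linear equations are dependent because `e² - 4st = m²`, so they have a common nonzero
integer solution. Coordinates of opposite signs are handled by reversing the dart. -/
theorem exists_lake {m : ℤ} (hm : 0 < m) (hD : T.HasDiscriminant (m ^ 2)) :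
    ∃ d t, T.state d = ⟨0, t, m⟩ := by
  obtain ⟨v⟩ := T.isTree.connected.nonempty
  obtain ⟨w, hw⟩ : (T.graph.neighborSet v).Nonempty :=
    Set.nonempty_of_ncard_ne_zero (by rw [T.degree_three]; norm_num)
  let d : T.graph.Dart := ⟨(v, w), hw⟩
  have hd := hD.eq d
  obtain ⟨x, y, hxy, h1, h2⟩ : ∃ x y : ℤ, (x ≠ 0 ∨ y ≠ 0) ∧
      2 * (T.state d).left * x + ((T.state d).edge + m) * y = 0 ∧
      ((T.state d).edge - m) * x + 2 * (T.state d).right * y = 0 := by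
    by_cases h : (T.state d).edge + m = 0
    · refine ⟨2 * (T.state d).right, m - (T.state d).edge, Or.inr (by omega), ?_, ?_⟩
      · linear_combination -hd
      · ring
    · refine ⟨-((T.state d).edge + m), 2 * (T.state d).left, Or.inl (by omega), ?_, ?_⟩
      · ring
      · linear_combination -hd
  wlog hx : 0 ≤ x generalizing x y
  · refine this (-x) (-y) (by simpa using hxy) ?_ ?_ (by omega)
    · linear_combination -h1
    · linear_combination -h2
  by_cases hy : 0 ≤ y
  · exact exists_lake_of_nonneg (x + y).toNat d x y hx hy (by omega) (by omega) h1 h2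
  · refine exists_lake_of_nonneg (x - y).toNat d.symm (-y) x (by omega) hx (by omega) (by omega)
      ?_ ?_ <;> rw [state_symm] <;> simp only
    · linear_combination -h2
    · linear_combination h1

/-- Following a river to its end. -/
theorem exists_river_end {m : ℤ} (n : ℕ) (d : T.graph.Dart) (a b y z : ℤ) (ha : 0 < a)
    (hb : 0 < b) (hy : 0 < y) (hz : 0 < z) (hn : a + b ≤ n) (hm : a * z + b * y = m)
    (hd : T.state d = EdgeState.river a b y z) :
    ∃ (q : T.graph.Dart) (c c' : ℤ), 0 < c ∧ 0 < c' ∧ c + c' = m ∧ T.state q = ⟨0, -c', -m⟩ ∧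
      T.LakesAheadIn {T.left q} d ∧
      0 ≤ Real.log (a * b * c * c' / (y * z * (Int.gcd a b : ℝ) ^ 4)) / 2 ∧
      (T.state d).total m =
        ENNReal.ofReal (Real.log (a * b * c * c' / (y * z * (Int.gcd a b : ℝ) ^ 4)) / 2) +
        ((⟨0, c, m⟩ : EdgeState).total m + (⟨0, c', m⟩ : EdgeState).total m) := by
  induction n generalizing d a b y z with
  | zero => push_cast at hn; omega
  | succ n ih =>
    push_cast at hn
    have hl : ∀ S : Set T.Region, T.IsLakeRegion (T.left d) → T.left d ∈ S := by
      intro S h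
      have h1 : (T.state d).left = 0 := h
      rw [hd] at h1
      exact absurd h1 (mul_pos ha hy).ne'
    have hr : ∀ S : Set T.Region, T.IsLakeRegion (T.right d) → T.right d ∈ S := by
      intro S h
      have h1 : (T.state d).right = 0 := h
      rw [hd] at h1
      exact absurd (neg_eq_zero.1 h1) (mul_pos hb hz).ne'
    have ha' : (0 : ℝ) < a := by exact_mod_cast ha
    have hb' : (0 : ℝ) < b := by exact_mod_cast hb
    have hy' : (0 : ℝ) < y := by exact_mod_cast hy
    have hz' : (0 : ℝ) < z := by exact_mod_cast hz
    have hm' : (a * z + b * y : ℝ) = m := by exact_mod_cast hm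
    have hyz := mul_pos hy hz
    rcases lt_trichotomy b a with hab | rfl | hab
    · have hab' : (0 : ℝ) < a - b := by
        have : (b : ℝ) < a := by exact_mod_cast hab
        linarith
      obtain ⟨q, c, c', hc, hc', hcm, hq, hlake, hlog, htot⟩ := ih (T.turnRight d) (a - b) b (y + z)
        z (by omega) hb (by omega) hz (by omega) (by rw [← hm]; ring)
        (by rw [state_turnRight, hd, EdgeState.turn_false_river])
      refine ⟨q, c, c', hc, hc', hcm, hq, ?_, ?_⟩
      · refine .of_turn (hl _) (hr _) (lakesAheadIn_of_same_sign _ ?_ ?_) hlake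
        · rw [state_turnLeft, hd, EdgeState.turn_true_river]
          exact mul_pos (mul_pos ha hy) (mul_pos (by omega) (by omega))
        · rw [state_turnLeft, hd, EdgeState.turn_true_river]
          refine mul_pos (mul_pos ha hy) ?_
          simp only
          nlinarith [mul_pos ha hz, mul_pos ha hy, mul_pos (sub_pos.2 hab) hy]
      · have hcR : (0 : ℝ) < c := by exact_mod_cast hc
        have hcR' : (0 : ℝ) < c' := by exact_mod_cast hc'
        have hg : Int.gcd (a - b) b = Int.gcd a b := by
          rw [Int.gcd_sub_self_left]
        rw [hg] at hlog htot
        have hg0 : (0 : ℝ) < Int.gcd a b := by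
          exact_mod_cast Int.gcd_pos_of_ne_zero_left b ha.ne'
        have hstep : 0 ≤ Real.log ((a * (y + z)) / (y * (a - b) : ℝ)) / 2 := by
          refine div_nonneg (Real.log_nonneg ?_) two_pos.le
          rw [one_le_div (by positivity)]
          nlinarith [mul_pos ha' hz', mul_pos hb' hy']
        -- The quotient `ab / (yz)` changes by exactly the factor inside the logarithm of this river
        -- step, while `c`, `c'` and the gcd stay fixed.
        have heq : Real.log (a * b * c * c' / (y * z * (Int.gcd a b : ℝ) ^ 4)) / 2 =
            Real.log ((a * (y + z)) / (y * (a - b) : ℝ)) / 2 +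
            Real.log (((a - b : ℤ) : ℝ) * b * c * c' /
              (((y + z : ℤ) : ℝ) * z * (Int.gcd a b : ℝ) ^ 4)) / 2 := by
          push_cast
          rw [← add_div, ← Real.log_mul (by positivity) (by positivity)]
          congr 2
          field_simp
        rw [heq]
        refine ⟨add_nonneg hstep hlog, ?_⟩
        rw [ENNReal.ofReal_add hstep hlog, add_assoc, ← htot, hd, state_turnRight, hd,
          EdgeState.turn_false_river, EdgeState.total_river_of_lt hb hy hz hab hm']
    -- End of the river: `a = b = g`, and the labels `g y`, `-g z` flank the zero on the shore of
    -- the second lake. The logarithm is then `log 1`.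
    · refine ⟨T.turnRight d, b * y, b * z, mul_pos hb hy, mul_pos hb hz, by rw [← hm]; ring, ?_,
        ?_, ?_, ?_⟩
      · rw [state_turnRight, hd, EdgeState.turn_false_river, ← hm]
        ext <;> simp [EdgeState.river]
        ring
      · have hahead : T.right (T.turnLeft d) = T.left (T.turnRight d) := T.right_turnLeft d
        refine .of_turn (hl _) (hr _) (lakesAheadIn_of_right_mem ?_ ?_ ?_)
          (lakesAheadIn_of_left_mem ?_ ?_ ?_)
        · rw [hahead]; rfl
        · rw [state_turnLeft, hd, EdgeState.turn_true_river]
          simp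
        · rw [state_turnLeft, hd, EdgeState.turn_true_river]
          refine mul_pos (mul_pos ha hy) ?_
          simp only
          nlinarith [mul_pos ha hz, mul_pos ha hy]
        · rfl
        · rw [state_turnRight, hd, EdgeState.turn_false_river]
          simp [EdgeState.river]
        · rw [state_turnRight, hd, EdgeState.turn_false_river]
          refine mul_pos_of_neg_of_neg (neg_neg_of_pos (mul_pos hb hz)) ?_
          simp only [EdgeState.river]
          nlinarith [mul_pos hb hz, mul_pos hb hy]
      · have : (b * b * (b * y : ℤ) * (b * z : ℤ) / (y * z * (Int.gcd b b : ℝ) ^ 4) : ℝ) = 1 := by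
          have hg : ((Int.gcd b b : ℕ) : ℝ) = b := by
            rw [Int.gcd_self]
            rw [Nat.cast_natAbs, abs_of_pos hb]
          rw [hg]
          push_cast
          field_simp
        rw [this]
        simp
      · have : (b * b * (b * y : ℤ) * (b * z : ℤ) / (y * z * (Int.gcd b b : ℝ) ^ 4) : ℝ) = 1 := by
          have hg : ((Int.gcd b b : ℕ) : ℝ) = b := by
            rw [Int.gcd_self]
            rw [Nat.cast_natAbs, abs_of_pos hb]
          rw [hg]
          push_cast
          field_simp
        rw [this, hd, EdgeState.total_river_self (m := m) (by rw [← hm]; ring)]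
        simp
    · have hab' : (0 : ℝ) < b - a := by
        have : (a : ℝ) < b := by exact_mod_cast hab
        linarith
      obtain ⟨q, c, c', hc, hc', hcm, hq, hlake, hlog, htot⟩ := ih (T.turnLeft d) a (b - a) y
        (y + z) ha (by omega) hy (by omega) (by omega) (by rw [← hm]; ring)
        (by rw [state_turnLeft, hd, EdgeState.turn_true_river'])
      refine ⟨q, c, c', hc, hc', hcm, hq, ?_, ?_⟩
      · refine .of_turn (hl _) (hr _) hlake (lakesAheadIn_of_same_sign _ ?_ ?_)
        · rw [state_turnRight, hd, EdgeState.turn_false_river]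
          exact mul_pos_of_neg_of_neg (mul_neg_of_neg_of_pos (by omega) (by omega))
            (neg_neg_of_pos (mul_pos hb hz))
        · rw [state_turnRight, hd, EdgeState.turn_false_river]
          refine mul_pos_of_neg_of_neg (mul_neg_of_neg_of_pos (by omega) (by omega)) ?_
          simp only [EdgeState.river]
          nlinarith [mul_pos hb hz, mul_pos hb hy, mul_pos (sub_pos.2 hab) hz]
      · have hcR : (0 : ℝ) < c := by exact_mod_cast hc
        have hcR' : (0 : ℝ) < c' := by exact_mod_cast hc'
        have hg : Int.gcd a (b - a) = Int.gcd a b := by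
          rw [Int.gcd_sub_self_right]
        rw [hg] at hlog htot
        have hg0 : (0 : ℝ) < Int.gcd a b := by
          exact_mod_cast Int.gcd_pos_of_ne_zero_left b ha.ne'
        have hstep : 0 ≤ Real.log ((b * (z + y)) / (z * (b - a) : ℝ)) / 2 := by
          refine div_nonneg (Real.log_nonneg ?_) two_pos.le
          rw [one_le_div (by positivity)]
          nlinarith [mul_pos ha' hz', mul_pos hb' hy']
        have heq : Real.log (a * b * c * c' / (y * z * (Int.gcd a b : ℝ) ^ 4)) / 2 =
            Real.log ((b * (z + y)) / (z * (b - a) : ℝ)) / 2 +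
            Real.log (a * ((b - a : ℤ) : ℝ) * c * c' /
              (y * ((y + z : ℤ) : ℝ) * (Int.gcd a b : ℝ) ^ 4)) / 2 := by
          push_cast
          rw [← add_div, ← Real.log_mul (by positivity) (by positivity)]
          congr 2
          field_simp
          ring
        rw [heq]
        refine ⟨add_nonneg hstep hlog, ?_⟩
        rw [ENNReal.ofReal_add hstep hlog, add_assoc, ← htot, hd, state_turnLeft, hd,
          EdgeState.turn_true_river', EdgeState.total_river_swap,
          EdgeState.total_river_of_lt ha hz hy hab (by rw [← hm']; ring),
          EdgeState.total_river_swap, add_comm z y]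

theorem W₁_div_eq_of_modEq {m : ℕ} (hm : 1 ≤ m) {r s : ℤ} (h : r ≡ s [ZMOD m]) :
    W₁ ((r : ℝ) / m) = W₁ ((s : ℝ) / m) := by
  obtain ⟨k, hk⟩ := h.dvd
  have hm' : (m : ℝ) ≠ 0 := by positivity
  have : (s : ℝ) / m = r / m + k := by
    have h1 : (s : ℝ) = r + m * k := by
      have : s = r + m * k := by linarith
      exact_mod_cast this
    rw [h1]
    field_simp
  rw [this, W₁_add_int]

/-- The case of two adjacent lakes. -/
theorem sum_eq_of_adjacent_lakes {m : ℕ} (hm : 1 ≤ m) {d : T.graph.Dart}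
    (hd : T.state d = ⟨0, 0, m⟩) :
    (∀ C, T.IsLakeRegion C ↔ C = T.left d ∨ C = T.right d) ∧
      Summable (fun v : {v : V // ¬ T.IsLakeVertex v} => T.vertexTerm (m : ℝ) v.1) ∧
      (m : ℝ) ^ 3 * (∑' v : {v : V // ¬ T.IsLakeVertex v}, T.vertexTerm (m : ℝ) v.1) =
        2 * (1 - Real.log 2 - W₁ 0) := by
  have hm' : (0 : ℤ) < m := by omega
  have hmR : (0 : ℝ) < m := by exact_mod_cast hm
  have hs : T.state d.symm = ⟨0, 0, -m⟩ := by rw [state_symm, hd]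
  have hL : T.state (T.turnLeft d) = ⟨0, m, m⟩ := by
    rw [state_turnLeft, hd]; simp [EdgeState.turn]
  have hR : T.state (T.turnRight d) = ⟨m, 0, m⟩ := by
    rw [state_turnRight, hd]; simp [EdgeState.turn]
  have hsL : T.state (T.turnLeft d.symm) = ⟨0, -m, -m⟩ := by
    rw [state_turnLeft, hs]; simp [EdgeState.turn]
  have hsR : T.state (T.turnRight d.symm) = ⟨-m, 0, -m⟩ := by
    rw [state_turnRight, hs]; simp [EdgeState.turn]
  have hlA : T.IsLakeRegion (T.left d) := congrArg EdgeState.left hd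
  have hlB : T.IsLakeRegion (T.right d) := congrArg EdgeState.right hd
  refine ⟨fun C => ⟨fun hC => ?_, ?_⟩, ?_⟩
  · refine mem_of_lakesAheadIn (S := {T.left d, T.right d}) (d := d) ?_ ?_ hC
    · refine .of_turn (fun _ => by simp) (fun _ => by simp) (lakesAheadIn_of_left_mem ?_ ?_ ?_)
        (lakesAheadIn_of_right_mem ?_ ?_ ?_)
      · rw [T.left_turnLeft]; simp
      · rw [hL]
      · rw [hL]; positivity
      · rw [T.right_turnRight]; simp
      · rw [hR]
      · rw [hR]; positivity
    · refine .of_turn (fun _ => by simp [T.left_symm]) (fun _ => by simp [T.right_symm])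
        (lakesAheadIn_of_left_mem ?_ ?_ ?_) (lakesAheadIn_of_right_mem ?_ ?_ ?_)
      · rw [T.left_turnLeft, T.left_symm]; simp
      · rw [hsL]
      · rw [hsL]; simp only; nlinarith
      · rw [T.right_turnRight, T.right_symm]; simp
      · rw [hsR]
      · rw [hsR]; simp only; nlinarith
  · rintro (rfl | rfl)
    · exact hlA
    · exact hlB
  · have h1 : (⟨0, m, m⟩ : EdgeState).total (m : ℝ) = ENNReal.ofReal (lakeSum 1) := by
      have := EdgeState.total_lake_eq hm' hm'
      rw [Int.cast_natCast, div_self hmR.ne'] at this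
      exact this
    have hT1 : (T.state d).total (m : ℝ) = ENNReal.ofReal (2 * lakeSum 1) := by
      have h2 : (T.state d).term (m : ℝ) = 0 := by rw [hd]; simp [EdgeState.term]
      rw [EdgeState.total_eq, h2, ← state_turnLeft, ← state_turnRight, hL, hR, zero_add,
        show (⟨m, 0, m⟩ : EdgeState) = (⟨0, m, m⟩ : EdgeState).mirror from rfl,
        EdgeState.total_mirror, h1, two_mul,
        ENNReal.ofReal_add (lakeSum_nonneg one_pos) (lakeSum_nonneg one_pos)]
    have hT2 : (T.state d.symm).total (m : ℝ) = ENNReal.ofReal (2 * lakeSum 1) := by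
      rw [← hT1, hs, hd, ← EdgeState.total_neg]
      simp [EdgeState.neg]
    have h0 := lakeSum_nonneg one_pos
    -- Each lake has a positive and a negative shore starting next to the other lake, so `lakeSum 1`
    -- occurs four times.
    have h3 := T.summable_and_tsum_of_total_eq hmR (X := 2 * lakeSum 1 + 2 * lakeSum 1)
      (by positivity) d (by rw [hT1, hT2, ENNReal.ofReal_add (by positivity) (by positivity)])
    refine ⟨h3.1, h3.2.trans ?_⟩
    rw [two_mul_lakeSum_one]
    ring

/-- The case of two lakes that are not adjacent. -/
theorem sum_eq_of_river {m : ℕ} {d : T.graph.Dart} {a b : ℤ} (ha : 0 < a) (hb : 0 < b)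
    (hab : a + b = m) (hd : T.state d = ⟨0, -b, m⟩) :
    ∃ (q : T.graph.Dart) (c c' : ℤ), 0 < c ∧ 0 < c' ∧ c + c' = m ∧ T.state q = ⟨0, -c', -m⟩ ∧
      (∀ C, T.IsLakeRegion C ↔ C = T.left d ∨ C = T.left q) ∧
      Summable (fun v : {v : V // ¬ T.IsLakeVertex v} => T.vertexTerm (m : ℝ) v.1) ∧
      (m : ℝ) ^ 3 * (∑' v : {v : V // ¬ T.IsLakeVertex v}, T.vertexTerm (m : ℝ) v.1) =
        2 * Real.log (m / (2 * (Int.gcd a b : ℝ))) - W₁ (a / m) - W₁ (c / m) := by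
  have hm' : (0 : ℤ) < m := by omega
  have hmR : (0 : ℝ) < m := by exact_mod_cast hm'
  have hL : T.state (T.turnLeft d) = ⟨0, a, m⟩ := by
    rw [state_turnLeft, hd]; ext <;> simp [EdgeState.turn]; omega
  -- Between the consecutive shore labels `-b` and `a` the sign changes, and the river starts there
  -- with `y = z = 1`.
  have hR : T.state (T.turnRight d) = EdgeState.river a b 1 1 := by
    rw [state_turnRight, hd]; ext <;> simp [EdgeState.turn, EdgeState.river] <;> omega
  have hs : T.state d.symm = ⟨-b, 0, -m⟩ := by rw [state_symm, hd]
  obtain ⟨q, c, c', hc, hc', hcm, hq, hlake, hlog, htot⟩ := exists_river_end (m := m)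
    (a + b).toNat (T.turnRight d) a b 1 1 ha hb one_pos one_pos (by omega) (by omega) hR
  have hlA : T.IsLakeRegion (T.left d) := congrArg EdgeState.left hd
  have hlB : T.IsLakeRegion (T.left q) := congrArg EdgeState.left hq
  refine ⟨q, c, c', hc, hc', hcm, hq, fun C => ⟨fun hC => ?_, ?_⟩, ?_⟩
  · refine mem_of_lakesAheadIn (S := {T.left d, T.left q}) (d := d) ?_ ?_ hC
    · refine .of_turn (fun _ => by simp) (fun h => ?_) (lakesAheadIn_of_left_mem ?_ ?_ ?_) ?_
      · have h1 : (T.state d).right = 0 := h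
        rw [hd] at h1
        simp only at h1
        omega
      · rw [T.left_turnLeft]; simp
      · rw [hL]
      · rw [hL]; positivity
      · intro w
        exact ⟨fun h => Set.mem_insert_of_mem _ ((hlake w).1 h),
          fun h => Set.mem_insert_of_mem _ ((hlake w).2 h)⟩
    · refine lakesAheadIn_of_right_mem ?_ ?_ ?_
      · rw [T.right_symm]; simp
      · rw [hs]
      · rw [hs]; simp only; nlinarith
  · rintro (rfl | rfl)
    · exact hlA
    · exact hlB
  · obtain ⟨k1, k2⟩ := EdgeState.total_lake_add_total_lake ha hb hab
    obtain ⟨k3, k4⟩ := EdgeState.total_lake_add_total_lake hc hc' hcm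
    rw [Int.cast_natCast] at k1 k2 k3 k4 htot
    -- The positive shore, the negative shore and the river exhaust the vertices.
    have hT : (T.state d).total (m : ℝ) + (T.state d.symm).total (m : ℝ) =
        (⟨0, a, m⟩ : EdgeState).total m + (⟨0, b, m⟩ : EdgeState).total m +
          (T.state (T.turnRight d)).total m := by
      have h2 : (T.state d).term (m : ℝ) = 0 := by rw [hd]; simp [EdgeState.term]
      have h3 : T.state d.symm = (⟨0, b, m⟩ : EdgeState).mirror.neg := by
        rw [hs]; simp [EdgeState.neg, EdgeState.mirror]
      rw [EdgeState.total_eq, h2, ← state_turnLeft, ← state_turnRight, hL, h3,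
        EdgeState.total_neg, EdgeState.total_mirror]
      ring
    rw [htot, k1, k3, ← ENNReal.ofReal_add hlog k4, ← ENNReal.ofReal_add k2 (by positivity)] at hT
    have h3 := T.summable_and_tsum_of_total_eq hmR (by positivity) d hT
    refine ⟨h3.1, h3.2.trans ?_⟩
    have haR : (0 : ℝ) < a := by exact_mod_cast ha
    have hbR : (0 : ℝ) < b := by exact_mod_cast hb
    have hcR : (0 : ℝ) < c := by exact_mod_cast hc
    have hcR' : (0 : ℝ) < c' := by exact_mod_cast hc'
    have hg0 : (0 : ℝ) < Int.gcd a b := by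
      exact_mod_cast Int.gcd_pos_of_ne_zero_left b ha.ne'
    simp only [Int.cast_one, one_mul]
    rw [Real.log_div (by positivity) (by positivity), Real.log_div (by positivity) (by positivity),
      Real.log_div (by positivity) (by positivity), Real.log_div (by positivity) (by positivity),
      Real.log_mul (by positivity) (by positivity), Real.log_mul (by positivity) (by positivity),
      Real.log_mul (by positivity) (by positivity), Real.log_mul (by positivity) (by positivity),
      Real.log_mul (by positivity) (by positivity), Real.log_pow, Real.log_pow,
      Real.log_mul (by positivity) (by positivity)]
    push_cast
    ring

end Topograph

theorem theorem9p4 {V : Type*} (T : Topograph V) (m : ℕ) (hm : 1 ≤ m)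
    (hD : T.HasDiscriminant ((m : ℤ) ^ 2)) :
    ∃ A B : T.Region, A ≠ B ∧ (∀ C : T.Region, T.IsLakeRegion C ↔ C = A ∨ C = B) ∧
      (∃ r : ℤ, T.AdjacentResidue m A r) ∧ (∃ s : ℤ, T.AdjacentResidue m B s) ∧
      Summable (fun v : {v : V // ¬ T.IsLakeVertex v} => T.vertexTerm (m : ℝ) v.1) ∧
      ∀ r s : ℤ, T.AdjacentResidue m A r → T.AdjacentResidue m B s →
        (¬ T.Adjacent A B →
          (m : ℝ) ^ 3 * (∑' v : {v : V // ¬ T.IsLakeVertex v}, T.vertexTerm (m : ℝ) v.1) +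
              W₁ ((r : ℝ) / m) + W₁ ((s : ℝ) / m) =
            2 * Real.log ((m : ℝ) / (2 * (Int.gcd (m : ℤ) r : ℝ)))) ∧
        (T.Adjacent A B →
          (m : ℝ) ^ 3 * (∑' v : {v : V // ¬ T.IsLakeVertex v}, T.vertexTerm (m : ℝ) v.1) +
              W₁ ((r : ℝ) / m) + W₁ ((s : ℝ) / m) =
            2 * Real.log ((m : ℝ) / (2 * (Int.gcd (m : ℤ) r : ℝ))) + 2) := by
  have hm' : (0 : ℤ) < m := by omega
  have hmR : (0 : ℝ) < m := by exact_mod_cast hm'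
  obtain ⟨d₀, t, hd₀⟩ := Topograph.exists_lake hm' hD
  by_cases hdvd : (m : ℤ) ∣ t
  · obtain ⟨k, hk⟩ := hdvd
    obtain ⟨d, -, hd⟩ := Topograph.exists_state_eq_add_mul hd₀ (-k)
    have hd : T.state d = ⟨0, 0, m⟩ := by
      rw [hd, hk]; ext <;> simp; ring
    have hs : T.state d.symm = ⟨0, 0, -m⟩ := by rw [T.state_symm, hd]
    obtain ⟨hlakes, hsum, hval⟩ := Topograph.sum_eq_of_adjacent_lakes hm hd
    have hA : T.AdjacentResidue m (T.left d) 0 :=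
      Topograph.adjacentResidue_left hd dvd_rfl
    have hB : T.AdjacentResidue m (T.left d.symm) 0 :=
      Topograph.adjacentResidue_left hs (dvd_neg.2 dvd_rfl)
    refine ⟨T.left d, T.left d.symm, Topograph.left_ne_left hm' hd hs, hlakes, ⟨0, hA⟩, ⟨0, hB⟩,
      hsum, fun r s hr hs => ⟨fun hna => absurd (Topograph.exists_adjacent_left d) hna,
      fun _ => ?_⟩⟩
    have hr0 := hr.modEq hA
    rw [hval, Topograph.W₁_div_eq_of_modEq hm hr0,
      Topograph.W₁_div_eq_of_modEq hm (hs.modEq hB)]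
    have hg : Int.gcd (m : ℤ) r = m := by
      exact_mod_cast (Int.gcd_eq_left_iff_dvd hm'.le).2 (Int.modEq_zero_iff_dvd.1 hr0)
    rw [hg, show (m / (2 * m) : ℝ) = 2⁻¹ by field_simp, Real.log_inv]
    simp only [Int.cast_zero, zero_div]
    ring
  · have hpos : 0 < t % m := by
      have h1 := Int.emod_nonneg t hm'.ne'
      have h2 : t % m ≠ 0 := fun h => hdvd (Int.dvd_of_emod_eq_zero h)
      omega
    have hlt := Int.emod_lt_of_pos t hm'
    -- This shift selects the last negative label `t % m - m` before the sign change on the shore.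
    obtain ⟨d, -, hd⟩ := Topograph.exists_state_eq_add_mul hd₀ (-(t / m) - 1)
    have hd : T.state d = ⟨0, -(m - t % m), m⟩ := by
      rw [hd]
      ext <;> simp
      have := Int.emod_add_mul_ediv t m
      linarith
    obtain ⟨q, c, c', hc, hc', hcm, hq, hlakes, hsum, hval⟩ :=
      Topograph.sum_eq_of_river hpos (by omega) (by omega) hd
    have hA : T.AdjacentResidue m (T.left d) (-(m - t % m)) :=
      Topograph.adjacentResidue_left hd dvd_rfl
    have hB : T.AdjacentResidue m (T.left q) (-c') :=
      Topograph.adjacentResidue_left hq (dvd_neg.2 dvd_rfl)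
    refine ⟨T.left d, T.left q, Topograph.left_ne_left hm' hd hq, hlakes, ⟨_, hA⟩, ⟨_, hB⟩,
      hsum, fun r s hr hs => ⟨fun _ => ?_, fun hadj => ?_⟩⟩
    · have hr0 : r ≡ t % m [ZMOD m] :=
        (hr.modEq hA).trans (Int.modEq_iff_dvd.2 ⟨1, by ring⟩)
      have hs0 : s ≡ c [ZMOD m] :=
        (hs.modEq hB).trans (Int.modEq_iff_dvd.2 ⟨1, by rw [← hcm]; ring⟩)
      rw [hval, Topograph.W₁_div_eq_of_modEq hm hr0, Topograph.W₁_div_eq_of_modEq hm hs0]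
      have hg : Int.gcd (t % m) (m - t % m) = Int.gcd (m : ℤ) r := by
        obtain ⟨k, hk⟩ := hr0.dvd
        rw [Int.gcd_sub_self_right, Int.gcd_comm, show t % m = r + m * k by linarith,
          Int.gcd_add_mul_left_right]
      rw [hg]
      ring
    -- An adjacent second lake would put `0` into the residue class of the first, which is not
    -- divisible by `m`.
    · have h1 := hA _ hadj
      have h2 : T.label (T.left q) = 0 := (hlakes _).2 (Or.inr rfl)
      rw [h2] at h1
      have h3 := (Int.modEq_zero_iff_dvd.1 h1.symm)
      rw [dvd_neg] at h3
      have := Int.le_of_dvd (by omega) h3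
      omega
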